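/- Let $p_0:\mathbb R\to(0,\infty)$ be a differentiable, everywhere positive probability density such that, for some real constants $A,B$, $$|\partial_x\log p_0(x)|\le A+B|x|\qquad\text{for all }x\in\mathbb R .$$ Let $z\sim\mathcal N(0,1)$ be independent of $x_0\sim p_0$, and let $\alpha,\gamma:[0,1]\to\mathbb R$ be $C^1$ functions with $\alpha(0)=0$, $\alpha(1)=1$, $\gamma(0)=1$, $\gamma(1)=0$ and $\gamma(t)\ne0$ for $t\in(0,1)$. Put $x_t=\alpha(t)z+\gamma(t)x_0$ for $t\in[0,1]$. Then $x_0\sim p_0$, $x_1\sim\mathcal N(0,1)$, and every $x_t$ has a positive differentiable density $p_t$, namely $p_t(x)=\int_{\mathbb R}\frac{e^{-u^2/2}}{\sqrt{2\pi}}\,\frac{1}{|\gamma(t)|}\,p_0\!\left(\frac{x-\alpha(t)u}{\gamma(t)}\right)du$ for $t<1$, and the standard normal density for $t=1$. Let $F_t(x)=\int_{-\infty}^x p_t(u)\,du$, and for $t\in[0,1)$ let $$v(x,t)=\frac{\gamma'(t)}{\gamma(t)}\,x-\Bigl[\alpha(t)\alpha'(t)-\frac{\gamma'(t)}{\gamma(t)}\alpha(t)^2\Bigr]\partial_x\log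 p_t(x).$$ (1) For every $x_1\in\mathbb R$ there is a unique continuous function $t\mapsto x_t(x_1)$ on $[0,1]$ that has the value $x_1$ at $t=1$ and satisfies the backward ODE $\frac{d}{dt}x_t=v(x_t,t)$ for all $t\in[0,1)$ (with the one-sided derivative at $t=0$). It is $C^1$ on $[0,1)$. If moreover $\int|x|\,p_0(x)\,dx<\infty$, then it is $C^1$ on all of $[0,1]$, and its derivative at $t=1$ is $\alpha'(1)x_1+\gamma'(1)\int x\,p_0(x)\,dx$. (2) $F_0$ is a strictly increasing bijection of $\mathbb R$ onto $(0,1)$, $F_1$ takes values in $(0,1)$, and the map $g(x_1)=x_0(x_1)$ (the value of the solution at $t=0$) satisfies $g(x_1)=F_0^{-1}(F_1(x_1))$ for all $x_1\in\mathbb R$. (3) $g$ is strictly increasing and pushes $\mathcal N(0,1)$ forward to $p_0(x)\,dx$; and every nondecreasing $h:\mathbb R\to\mathbb R$ that pushes $\mathcal N(0,1)$ forward to $p_0(x)\,dx$ equals $g$ everywhere. -/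

import Mathlib

open MeasureTheory ProbabilityTheory Set

noncomputable section

namespace ProbabilityFlow

/-- An everywhere positive, differentiable probability density on `ℝ`
(so that its score `(log p)'` makes sense at every point). -/
structure IsPositiveDensity (p : ℝ → ℝ) : Prop where
  pos : ∀ x, 0 < p x
  differentiable : Differentiable ℝ p
  integral_eq_one : ∫ x, p x = 1

/-- The measure `p(x) dx` on `ℝ`. -/
def densityMeasure (p : ℝ → ℝ) : Measure ℝ :=
  volume.withDensity (fun x => ENNReal.ofReal (p x))

/-- The score `∂ₓ log p`. -/
def score (p : ℝ → ℝ) (x : ℝ) : ℝ :=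
  deriv (fun y => Real.log (p y)) x

/-- A `C¹` interpolation schedule on `[0,1]`. -/
structure IsSchedule (α γ : ℝ → ℝ) : Prop where
  contDiffOn_α : ContDiffOn ℝ 1 α (Icc 0 1)
  contDiffOn_γ : ContDiffOn ℝ 1 γ (Icc 0 1)
  α_zero : α 0 = 0
  α_one : α 1 = 1
  γ_zero : γ 0 = 1
  γ_one : γ 1 = 0
  γ_ne_zero : ∀ t ∈ Ioo (0 : ℝ) 1, γ t ≠ 0

/-- The derivative on `[0,1]` (one-sided at the endpoints). -/
def timeDeriv (f : ℝ → ℝ) (t : ℝ) : ℝ :=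
  derivWithin f (Icc 0 1) t

/-- The forward process `x_t = α(t) z + γ(t) x₀`. -/
def forwardProcess {Ω : Type*} (α γ : ℝ → ℝ) (z x₀ : Ω → ℝ) (t : ℝ) (ω : Ω) : ℝ :=
  α t * z ω + γ t * x₀ ω

/-- The density `p_t` of `α(t) z + γ(t) x₀`, where `z ∼ N(0,1)` and `x₀ ∼ p₀` are independent:
the Gaussian average over `z` of the density of `α(t) z + γ(t) x₀` for fixed `z`; if `γ(t) = 0`,
it is the density of `N(0, α(t)²)`. -/
def marginalDensity (p₀ α γ : ℝ → ℝ) (t x : ℝ) : ℝ :=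
  if γ t = 0 then gaussianPDFReal 0 ⟨α t ^ 2, sq_nonneg (α t)⟩ x
  else ∫ z, gaussianPDFReal 0 1 z * (|γ t|⁻¹ * p₀ ((x - α t * z) / γ t))

/-- The distribution function `F_t(x) = ∫_{-∞}^x p_t(u) du`. -/
def marginalCDF (p₀ α γ : ℝ → ℝ) (t x : ℝ) : ℝ :=
  ∫ u in Iic x, marginalDensity p₀ α γ t u

/-- The velocity field of the probability-flow ODE; it is meaningful where `γ(t) ≠ 0`. -/
def velocity (p₀ α γ : ℝ → ℝ) (x t : ℝ) : ℝ :=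
  timeDeriv γ t / γ t * x
    - (α t * timeDeriv α t - timeDeriv γ t / γ t * α t ^ 2)
      * score (marginalDensity p₀ α γ t) x

/-- `x` is a solution on `[0,1]` of the backward ODE `x' = v(x,t)` started from `x(1) = x₁`:
it is continuous on `[0,1]`, has the terminal value `x₁`, and satisfies the equation at every time
`t ∈ [0,1)`, i.e. wherever the velocity field is defined (the formula divides by `γ(1) = 0` at
`t = 1`). -/
structure IsBackwardSolution (p₀ α γ : ℝ → ℝ) (x₁ : ℝ) (x : ℝ → ℝ) : Prop where
  continuousOn : ContinuousOn x (Icc 0 1)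
  terminal : x 1 = x₁
  hasDerivWithinAt : ∀ t ∈ Ico (0 : ℝ) 1,
    HasDerivWithinAt x (velocity p₀ α γ (x t) t) (Icc 0 1) t

end ProbabilityFlow

end

/-!
With `r = α / γ` and `Z` standard Gaussian, `x_t` has the law of `γ(t) (X + r(t) Z)`, where `X` has
density `p₀`. If `q_a` is the density of `X + a Z`, the heat equation gives
`∂ₐ P(X + a Z ≤ x) = a q_a'(x)`, and in the coordinate `x / γ(t)` with clock `r` the
probability-flow ODE is `dx/da = -a q_a'(x) / q_a(x)`: it says exactly that `F_t` is constant along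
the trajectory. By Stein's identity `a q_a'(x) = -E[Z p₀(x - a Z)]`, which is jointly continuous in
`(a, x)` up to `a = 0`, so `P(X + a Z ≤ x)` is `C¹`. Its level curves are then `C¹` by the implicit
function theorem, and the only solution ending at `x₁` follows the quantile of level `F_1(x₁)`. Near
`t = 1`, where `r` blows up, Tweedie's formula rewrites the velocity as
`(α'/α) x + (γ' - α' γ / α) E[x₀ | x_t = x]`, which has a limit when `p₀` has a first moment.
-/

namespace ProbabilityFlow

open Filter Topology

/-! ### Gaussian averages -/

lemma continuous_gaussianPDFReal (μ : ℝ) (v : NNReal) : Continuous (gaussianPDFReal μ v) := by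
  rw [gaussianPDFReal_def]; fun_prop

lemma integral_gaussianReal_zero_one (f : ℝ → ℝ) :
    ∫ z, f z ∂(gaussianReal 0 1) = ∫ z, gaussianPDFReal 0 1 z * f z :=
  integral_gaussianReal_eq_integral_smul one_ne_zero

lemma integrable_gaussianReal_zero_one_iff {f : ℝ → ℝ} :
    Integrable f (gaussianReal 0 1) ↔ Integrable (fun z => gaussianPDFReal 0 1 z * f z) := by
  rw [gaussianReal_of_var_ne_zero _ one_ne_zero,
    integrable_withDensity_iff_integrable_smul' (measurable_gaussianPDF 0 1)
      (ae_of_all _ fun z => gaussianPDF_lt_top)]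
  simp only [toReal_gaussianPDF, smul_eq_mul]

lemma integrable_pow_gaussianReal (k : ℕ) : Integrable (fun z : ℝ => z ^ k) (gaussianReal 0 1) :=
  integrable_pow_of_mem_interior_integrableExpSet (X := id) (by simp) k

/-- Since `|z|ᵏ / k! ≤ exp |z|` and `|z| - z² / 2 ≤ 1 / 2`. -/
lemma abs_pow_mul_gaussianPDFReal_le (k : ℕ) (z : ℝ) :
    |z| ^ k * gaussianPDFReal 0 1 z ≤ k.factorial * Real.exp 2⁻¹ := by
  have hpow : |z| ^ k ≤ k.factorial * Real.exp |z| := by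
    rw [← div_le_iff₀' (by positivity)]
    exact Real.pow_div_factorial_le_exp _ (abs_nonneg z) k
  have hpdf : gaussianPDFReal 0 1 z ≤ Real.exp (-z ^ 2 / 2) := by
    have hconst : (√(2 * Real.pi))⁻¹ ≤ 1 :=
      inv_le_one_of_one_le₀ (Real.one_le_sqrt.2 (by linarith [Real.pi_gt_three]))
    simpa [gaussianPDFReal] using mul_le_of_le_one_left (Real.exp_pos (-z ^ 2 / 2)).le hconst
  calc |z| ^ k * gaussianPDFReal 0 1 z
      ≤ k.factorial * Real.exp |z| * Real.exp (-z ^ 2 / 2) := by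
        gcongr; exact gaussianPDFReal_nonneg 0 1 z
    _ = k.factorial * Real.exp (|z| + -z ^ 2 / 2) := by rw [mul_assoc, ← Real.exp_add]
    _ ≤ k.factorial * Real.exp 2⁻¹ := by
        gcongr; nlinarith [sq_nonneg (|z| - 1), sq_abs z]

/-- The Gaussian average `∫ zᵏ f(x - a z) dN(z)`. For `k = 0` and the density `f` of a random
variable `X`, it is the density of `X + a Z`, where `Z ∼ N(0, 1)` is independent of `X`. -/
noncomputable def gaussianSmoothing (f : ℝ → ℝ) (k : ℕ) (a x : ℝ) : ℝ :=
  ∫ z, z ^ k * f (x - a * z) ∂(gaussianReal 0 1)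

section GaussianSmoothing

variable {f : ℝ → ℝ}

lemma gaussianSmoothing_zero_left (f : ℝ → ℝ) : gaussianSmoothing f 0 0 = f := by
  ext x; simp [gaussianSmoothing]

lemma gaussianSmoothing_one_zero (f : ℝ → ℝ) (x : ℝ) : gaussianSmoothing f 1 0 x = 0 := by
  simp [gaussianSmoothing, integral_mul_const]

lemma integrable_pow_mul_comp_sub_mul (hf : Integrable f) (k : ℕ) (a x : ℝ) :
    Integrable (fun z => z ^ k * f (x - a * z)) (gaussianReal 0 1) := by
  obtain rfl | ha := eq_or_ne a 0
  · simpa using (integrable_pow_gaussianReal k).mul_const (f x)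
  have hcomp : Integrable fun z => f (x - a * z) := (hf.comp_sub_left x).comp_mul_left' ha
  refine integrable_gaussianReal_zero_one_iff.2 ?_
  simp only [← mul_assoc]
  refine hcomp.bdd_mul (c := k.factorial * Real.exp 2⁻¹)
    ((continuous_gaussianPDFReal 0 1).mul (continuous_pow k)).aestronglyMeasurable
    (ae_of_all _ fun z => ?_)
  rw [norm_mul, norm_pow, Real.norm_of_nonneg (gaussianPDFReal_nonneg 0 1 z), mul_comm]
  exact abs_pow_mul_gaussianPDFReal_le k z

lemma gaussianSmoothing_add {g : ℝ → ℝ} (hf : Integrable f) (hg : Integrable g) (k : ℕ)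
    (a x : ℝ) :
    gaussianSmoothing (f + g) k a x = gaussianSmoothing f k a x + gaussianSmoothing g k a x := by
  simp only [gaussianSmoothing, Pi.add_apply, mul_add]
  exact integral_add (integrable_pow_mul_comp_sub_mul hf k a x)
    (integrable_pow_mul_comp_sub_mul hg k a x)

lemma abs_mul_integral_abs_comp_sub_mul_le (f : ℝ → ℝ) (a x : ℝ) :
    |a| * ∫ z, |f (x - a * z)| ≤ ∫ y, |f y| := by
  obtain rfl | ha := eq_or_ne a 0
  · simpa using integral_nonneg fun y => abs_nonneg (f y)
  rw [Measure.integral_comp_mul_left (fun w => |f (x - w)|), smul_eq_mul, abs_inv,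
    mul_inv_cancel_left₀ (abs_ne_zero.2 ha), integral_sub_left_eq_self (fun w => |f w|)]

/-- On the support of the integrand `|a z| ≥ R - |x|`, so one factor `z` can be traded for `a`; this
makes the bound uniform in `a`, including near `a = 0`. -/
lemma abs_gaussianSmoothing_le_of_eq_zero (hf : Integrable f) {R : ℝ}
    (hR : ∀ w, |w| < R → f w = 0) (k : ℕ) (a : ℝ) {x : ℝ} (hx : |x| < R) :
    |gaussianSmoothing f k a x|
      ≤ (k + 1).factorial * Real.exp 2⁻¹ / (R - |x|) * ∫ y, |f y| := by
  set C : ℝ := (k + 1).factorial * Real.exp 2⁻¹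
  have hRx : 0 < R - |x| := sub_pos.2 hx
  have hpt (z : ℝ) : |gaussianPDFReal 0 1 z * (z ^ k * f (x - a * z))|
      ≤ C / (R - |x|) * (|a| * |f (x - a * z)|) := by
    by_cases hz : |x - a * z| < R
    · simp [hR _ hz]
    have hdist : R - |x| ≤ |a| * |z| := by
      linarith [abs_sub x (a * z), abs_mul a z, not_lt.1 hz]
    rw [abs_mul, abs_mul, abs_pow, abs_of_nonneg (gaussianPDFReal_nonneg 0 1 z), ← mul_assoc,
      ← mul_assoc]
    refine mul_le_mul_of_nonneg_right ?_ (abs_nonneg _)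
    rw [div_mul_eq_mul_div, le_div_iff₀ hRx]
    calc gaussianPDFReal 0 1 z * |z| ^ k * (R - |x|)
        ≤ gaussianPDFReal 0 1 z * |z| ^ k * (|a| * |z|) := by
          gcongr; exact mul_nonneg (gaussianPDFReal_nonneg 0 1 z) (by positivity)
      _ = |z| ^ (k + 1) * gaussianPDFReal 0 1 z * |a| := by ring
      _ ≤ C * |a| := by gcongr; exact abs_pow_mul_gaussianPDFReal_le (k + 1) z
  have hint : Integrable fun z => |a| * |f (x - a * z)| := by
    obtain rfl | ha := eq_or_ne a 0
    · simp
    · exact (((hf.comp_sub_left x).comp_mul_left' ha).abs).const_mul _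
  rw [gaussianSmoothing, integral_gaussianReal_zero_one]
  calc |∫ z, gaussianPDFReal 0 1 z * (z ^ k * f (x - a * z))|
      ≤ ∫ z, |gaussianPDFReal 0 1 z * (z ^ k * f (x - a * z))| := abs_integral_le_integral_abs
    _ ≤ ∫ z, C / (R - |x|) * (|a| * |f (x - a * z)|) :=
        integral_mono_of_nonneg (ae_of_all _ fun z => abs_nonneg _) (hint.const_mul _)
          (ae_of_all _ hpt)
    _ = C / (R - |x|) * (|a| * ∫ z, |f (x - a * z)|) := by
        rw [integral_const_mul, integral_const_mul]
    _ ≤ C / (R - |x|) * ∫ y, |f y| := by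
        gcongr; exact abs_mul_integral_abs_comp_sub_mul_le f a x

lemma continuous_gaussianSmoothing_of_bounded (hf : Continuous f) {C : ℝ}
    (hC : ∀ w, |f w| ≤ C) (k : ℕ) :
    Continuous fun q : ℝ × ℝ => gaussianSmoothing f k q.1 q.2 := by
  refine continuous_of_dominated (bound := fun z => |z ^ k| * C) (fun q => ?_) (fun q => ?_)
    ((integrable_pow_gaussianReal k).abs.mul_const C) (ae_of_all _ fun z => by fun_prop)
  · exact Continuous.aestronglyMeasurable (by fun_prop)
  · refine ae_of_all _ fun z => ?_
    rw [norm_mul]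
    exact mul_le_mul_of_nonneg_left (hC _) (abs_nonneg _)

lemma exists_bounded_add_eq_zero_near_origin (hf : Continuous f) (hfi : Integrable f) (R : ℝ) :
    ∃ g h : ℝ → ℝ, f = g + h ∧ Continuous g ∧ (∃ C, ∀ w, |g w| ≤ C) ∧ Integrable g ∧
      Integrable h ∧ (∀ w, |w| < R → h w = 0) ∧ ∫ y, |h y| ≤ ∫ y, |f y| := by
  set χ : ℝ → ℝ := fun w => max 0 (min 1 (R + 1 - |w|)) with hχ
  have hχ_mem (w : ℝ) : χ w ∈ Icc (0 : ℝ) 1 :=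
    ⟨le_max_left _ _, max_le zero_le_one (min_le_left _ _)⟩
  have hχ_cont : Continuous χ := by fun_prop
  have hg : Integrable fun w => χ w * f w :=
    hfi.bdd_mul (c := 1) hχ_cont.aestronglyMeasurable (ae_of_all _ fun w => by
      rw [Real.norm_of_nonneg (hχ_mem w).1]; exact (hχ_mem w).2)
  have hh : Integrable fun w => (1 - χ w) * f w := by
    simp only [sub_mul, one_mul]; exact hfi.sub hg
  refine ⟨fun w => χ w * f w, fun w => (1 - χ w) * f w, ?_, hχ_cont.mul hf, ?_, hg, hh, ?_, ?_⟩
  · ext w; simp only [Pi.add_apply]; ring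
  · refine (hχ_cont.mul hf).bounded_above_of_compact_support <|
      HasCompactSupport.intro (isCompact_closedBall 0 (R + 1)) fun w hw => ?_
    have : R + 1 < |w| := by simpa using hw
    simp [hχ, this.le]
  · intro w hw
    have : (1 : ℝ) ≤ R + 1 - |w| := by linarith
    simp [hχ, this]
  · refine integral_mono hh.abs hfi.abs fun w => ?_
    simp only [abs_mul, abs_of_nonneg (sub_nonneg.2 (hχ_mem w).2)]
    exact mul_le_of_le_one_left (abs_nonneg _) (by linarith [(hχ_mem w).1])

/-- Near any point, cutting `f` off outside a large ball changes the average by little, uniformly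
in `a`. -/
lemma continuous_gaussianSmoothing (hf : Continuous f) (hfi : Integrable f) (k : ℕ) :
    Continuous fun q : ℝ × ℝ => gaussianSmoothing f k q.1 q.2 := by
  refine continuous_of_locally_uniform_approx_of_continuousAt fun q₀ u hu => ?_
  obtain ⟨ε, hε, hεu⟩ := Metric.mem_uniformity_dist.1 hu
  set M : ℝ := (k + 1).factorial * Real.exp 2⁻¹ * ∫ y, |f y|
  have hM : 0 ≤ M := mul_nonneg (by positivity) (integral_nonneg fun y => abs_nonneg (f y))
  set R : ℝ := |q₀.2| + 1 + (M / ε + 1) with hR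
  obtain ⟨g, h, hfgh, hg_cont, ⟨C, hC⟩, hg, hh, hh_zero, hh_le⟩ :=
    exists_bounded_add_eq_zero_near_origin hf hfi R
  refine ⟨{q | |q.2| < |q₀.2| + 1},
    (continuous_snd.abs.continuousAt).eventually_lt_const (lt_add_one _),
    fun q => gaussianSmoothing g k q.1 q.2,
    (continuous_gaussianSmoothing_of_bounded hg_cont hC k).continuousAt, fun q hq => hεu ?_⟩
  have hgap : M / ε + 1 < R - |q.2| := by rw [hR]; linarith [hq.out]
  have hgap_pos : 0 < R - |q.2| :=
    (add_pos_of_nonneg_of_pos (div_nonneg hM hε.le) one_pos).trans hgap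
  calc dist (gaussianSmoothing f k q.1 q.2) (gaussianSmoothing g k q.1 q.2)
      = |gaussianSmoothing h k q.1 q.2| := by
        conv_lhs => rw [hfgh, gaussianSmoothing_add hg hh]
        rw [Real.dist_eq, add_sub_cancel_left]
    _ ≤ (k + 1).factorial * Real.exp 2⁻¹ / (R - |q.2|) * ∫ y, |h y| :=
        abs_gaussianSmoothing_le_of_eq_zero hh hh_zero k q.1 (sub_pos.1 hgap_pos)
    _ ≤ (k + 1).factorial * Real.exp 2⁻¹ / (R - |q.2|) * ∫ y, |f y| := by gcongr
    _ = M / (R - |q.2|) := div_mul_eq_mul_div _ _ _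
    _ < ε := by
        rw [div_lt_iff₀ hgap_pos, ← div_lt_iff₀' hε]; linarith

/-! ### The heat equation -/

lemma gaussianSmoothing_eq_integral_kernel (f : ℝ → ℝ) (k : ℕ) {a : ℝ} (ha : a ≠ 0) (x : ℝ) :
    gaussianSmoothing f k a x
      = |a|⁻¹ * ∫ y, ((x - y) / a) ^ k * gaussianPDFReal 0 1 ((x - y) / a) * f y := by
  set G : ℝ → ℝ := fun y => ((x - y) / a) ^ k * gaussianPDFReal 0 1 ((x - y) / a) * f y
  rw [← integral_sub_left_eq_self G volume x, ← abs_inv, ← smul_eq_mul,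
    ← Measure.integral_comp_mul_left (fun w => G (x - w)), gaussianSmoothing,
    integral_gaussianReal_zero_one]
  congr with z
  simp only [G, sub_sub_cancel, mul_div_cancel_left₀ _ ha]
  ring

lemma hasDerivAt_gaussianPDFReal_zero_one (z : ℝ) :
    HasDerivAt (gaussianPDFReal 0 1) (-z * gaussianPDFReal 0 1 z) z := by
  have h : HasDerivAt (fun x : ℝ => -(x - 0) ^ 2 / (2 * ((1 : NNReal) : ℝ))) (-z) z := by
    have := ((((hasDerivAt_id z).sub_const 0).pow 2).neg).div_const (2 * ((1 : NNReal) : ℝ))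
    refine this.congr_deriv ?_
    simp only [id_eq, NNReal.coe_one]
    ring
  rw [gaussianPDFReal_def]
  refine (h.exp.const_mul _).congr_deriv ?_
  ring

lemma hasDerivAt_gaussianSmoothing (hf : Integrable f) {a : ℝ} (ha : a ≠ 0) (x : ℝ) :
    HasDerivAt (gaussianSmoothing f 0 a) (-gaussianSmoothing f 1 a x / a) x := by
  have hφ := continuous_gaussianPDFReal 0 1
  have hbound (k : ℕ) (z : ℝ) :
      ‖z ^ k * gaussianPDFReal 0 1 z‖ ≤ k.factorial * Real.exp 2⁻¹ := by
    rw [norm_mul, norm_pow, Real.norm_of_nonneg (gaussianPDFReal_nonneg 0 1 z)]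
    exact abs_pow_mul_gaussianPDFReal_le k z
  have hint : Integrable fun y => gaussianPDFReal 0 1 ((x - y) / a) * f y :=
    hf.bdd_mul (hφ.comp (by fun_prop)).aestronglyMeasurable
      (ae_of_all _ fun y => by simpa using hbound 0 ((x - y) / a))
  have hderiv := (hasDerivAt_integral_of_dominated_loc_of_deriv_le (x₀ := x) (s := univ)
    (F := fun x y => gaussianPDFReal 0 1 ((x - y) / a) * f y)
    (F' := fun x y => -((x - y) / a) * gaussianPDFReal 0 1 ((x - y) / a) * (1 / a) * f y)
    (bound := fun y => Nat.factorial 1 * Real.exp 2⁻¹ * ‖1 / a‖ * ‖f y‖) univ_mem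
    (.of_forall fun x => (hφ.comp (by fun_prop)).aestronglyMeasurable.mul hf.1) hint
    (Continuous.aestronglyMeasurable (by fun_prop) |>.mul hf.1)
    (ae_of_all _ fun y x _ => ?_) (hf.norm.const_mul _) (ae_of_all _ fun y x _ => ?_)).2
  · have h := hderiv.const_mul |a|⁻¹
    refine (h.congr_deriv ?_).congr_of_eventuallyEq (.of_forall fun x => ?_)
    · rw [gaussianSmoothing_eq_integral_kernel f 1 ha, neg_div, mul_div_assoc, ← integral_div,
        ← mul_neg, ← integral_neg]
      congr 2 with y
      ring
    · simpa using gaussianSmoothing_eq_integral_kernel f 0 ha x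
  · rw [norm_mul, norm_mul, neg_mul, norm_neg]
    gcongr
    simpa using hbound 1 ((x - y) / a)
  · refine HasDerivAt.mul_const ?_ (f y)
    exact HasDerivAt.comp (h₂ := gaussianPDFReal 0 1) x
      (hasDerivAt_gaussianPDFReal_zero_one ((x - y) / a))
      (((hasDerivAt_id x).sub_const y).div_const a)

lemma differentiable_gaussianSmoothing (hf : Differentiable ℝ f) (hfi : Integrable f) (a : ℝ) :
    Differentiable ℝ (gaussianSmoothing f 0 a) := by
  obtain rfl | ha := eq_or_ne a 0
  · rwa [gaussianSmoothing_zero_left]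
  · exact fun x => (hasDerivAt_gaussianSmoothing hfi ha x).differentiableAt

/-- Stein's identity. -/
lemma mul_deriv_gaussianSmoothing (hf : Integrable f) (a x : ℝ) :
    a * deriv (gaussianSmoothing f 0 a) x = -gaussianSmoothing f 1 a x := by
  obtain rfl | ha := eq_or_ne a 0
  · simp [gaussianSmoothing_one_zero]
  · rw [(hasDerivAt_gaussianSmoothing hf ha x).deriv, mul_div_cancel₀ _ ha]

end GaussianSmoothing

/-! ### Distribution functions of positive densities -/

lemma integral_Iic_add_intervalIntegral {p : ℝ → ℝ} (hp : Integrable p) (a x : ℝ) :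
    (∫ u in Iic x, p u) = (∫ u in Iic a, p u) + ∫ u in a..x, p u := by
  have := intervalIntegral.integral_Iic_sub_Iic (μ := volume) (f := p) (a := a) (b := x)
    hp.integrableOn hp.integrableOn
  linarith

lemma densityMeasure_singleton (p : ℝ → ℝ) (x : ℝ) : densityMeasure p {x} = 0 :=
  withDensity_absolutelyContinuous _ _ (measure_singleton x)

namespace IsPositiveDensity

variable {p : ℝ → ℝ}

lemma continuous (hp : IsPositiveDensity p) : Continuous p := hp.differentiable.continuous

lemma integrable (hp : IsPositiveDensity p) : Integrable p :=
  integrable_of_integral_eq_one hp.integral_eq_one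

lemma hasDerivAt_cdf (hp : IsPositiveDensity p) (x : ℝ) :
    HasDerivAt (fun y => ∫ u in Iic y, p u) (p x) x := by
  rw [funext (integral_Iic_add_intervalIntegral hp.integrable 0)]
  exact (hp.continuous.integral_hasStrictDerivAt 0 x).hasDerivAt.const_add _

lemma continuous_cdf (hp : IsPositiveDensity p) : Continuous (fun y => ∫ u in Iic y, p u) :=
  continuous_iff_continuousAt.2 fun x => (hp.hasDerivAt_cdf x).continuousAt

lemma strictMono_cdf (hp : IsPositiveDensity p) : StrictMono (fun y => ∫ u in Iic y, p u) :=
  strictMono_of_deriv_pos fun x => by rw [(hp.hasDerivAt_cdf x).deriv]; exact hp.pos x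

lemma isProbabilityMeasure (hp : IsPositiveDensity p) :
    IsProbabilityMeasure (densityMeasure p) := by
  refine ⟨?_⟩
  rw [densityMeasure, withDensity_apply _ .univ, setLIntegral_univ,
    ← ofReal_integral_eq_lintegral_ofReal hp.integrable (ae_of_all _ fun x => (hp.pos x).le),
    hp.integral_eq_one, ENNReal.ofReal_one]

lemma densityMeasure_apply (hp : IsPositiveDensity p) {s : Set ℝ} (hs : MeasurableSet s) :
    densityMeasure p s = ENNReal.ofReal (∫ u in s, p u) := by
  rw [densityMeasure, withDensity_apply _ hs,
    ofReal_integral_eq_lintegral_ofReal hp.integrable.integrableOn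
      (ae_of_all _ fun x => (hp.pos x).le)]

lemma densityMeasure_real_Iic (hp : IsPositiveDensity p) (x : ℝ) :
    (densityMeasure p).real (Iic x) = ∫ u in Iic x, p u := by
  rw [measureReal_def, hp.densityMeasure_apply measurableSet_Iic,
    ENNReal.toReal_ofReal (integral_nonneg fun x => (hp.pos x).le)]

lemma tendsto_cdf_atBot (hp : IsPositiveDensity p) :
    Tendsto (fun y => ∫ u in Iic y, p u) atBot (𝓝 0) := by
  have := hp.isProbabilityMeasure
  refine (ProbabilityTheory.tendsto_cdf_atBot (densityMeasure p)).congr fun x => ?_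
  rw [cdf_eq_real, hp.densityMeasure_real_Iic]

lemma tendsto_cdf_atTop (hp : IsPositiveDensity p) :
    Tendsto (fun y => ∫ u in Iic y, p u) atTop (𝓝 1) := by
  have := hp.isProbabilityMeasure
  refine (ProbabilityTheory.tendsto_cdf_atTop (densityMeasure p)).congr fun x => ?_
  rw [cdf_eq_real, hp.densityMeasure_real_Iic]

lemma cdf_mem_Ioo (hp : IsPositiveDensity p) (x : ℝ) : (∫ u in Iic x, p u) ∈ Ioo (0 : ℝ) 1 :=
  ⟨(hp.strictMono_cdf.monotone.le_of_tendsto hp.tendsto_cdf_atBot (x - 1)).trans_lt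
      (hp.strictMono_cdf (sub_one_lt x)),
    (hp.strictMono_cdf (lt_add_one x)).trans_le
      (hp.strictMono_cdf.monotone.ge_of_tendsto hp.tendsto_cdf_atTop (x + 1))⟩

lemma exists_cdf_eq (hp : IsPositiveDensity p) {c : ℝ} (hc : c ∈ Ioo (0 : ℝ) 1) :
    ∃ x, (∫ u in Iic x, p u) = c :=
  mem_range_of_exists_le_of_exists_ge hp.continuous_cdf
    (hp.tendsto_cdf_atBot.eventually_le_const hc.1).exists
    (hp.tendsto_cdf_atTop.eventually_const_le hc.2).exists

lemma bijOn_cdf (hp : IsPositiveDensity p) :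
    BijOn (fun y => ∫ u in Iic y, p u) univ (Ioo 0 1) :=
  ⟨fun x _ => hp.cdf_mem_Ioo x, hp.strictMono_cdf.injective.injOn,
    fun _ hc => (hp.exists_cdf_eq hc).imp fun _ h => ⟨mem_univ _, h⟩⟩

lemma score_eq (hp : IsPositiveDensity p) (x : ℝ) : score p x = deriv p x / p x :=
  ((hp.differentiable x).hasDerivAt.log (hp.pos x).ne').deriv

end IsPositiveDensity

/-! ### The law of `X + a Z` -/

instance (p : ℝ → ℝ) : SFinite (densityMeasure p) := by
  unfold densityMeasure; infer_instance

section

variable {p : ℝ → ℝ}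

lemma densityMeasure_gaussianSmoothing (hp0 : 0 ≤ p) (hpm : Measurable p) (hpi : Integrable p)
    (a : ℝ) :
    densityMeasure (gaussianSmoothing p 0 a) =
      ((gaussianReal 0 1).prod (densityMeasure p)).map (fun ω => ω.2 + a * ω.1) := by
  ext s hs
  have hadd : Measurable fun ω : ℝ × ℝ => ω.2 + a * ω.1 := by fun_prop
  rw [Measure.map_apply hadd hs, Measure.prod_apply (hadd hs), densityMeasure,
    withDensity_apply _ hs]
  calc ∫⁻ x in s, ENNReal.ofReal (gaussianSmoothing p 0 a x)
      = ∫⁻ x in s, ∫⁻ z, ENNReal.ofReal (p (x - a * z)) ∂(gaussianReal 0 1) := by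
        congr with x
        simp only [gaussianSmoothing, pow_zero, one_mul]
        exact ofReal_integral_eq_lintegral_ofReal
          (by simpa using integrable_pow_mul_comp_sub_mul hpi 0 a x)
          (ae_of_all _ fun z => hp0 (x - a * z))
    _ = ∫⁻ z, (∫⁻ x in s, ENNReal.ofReal (p (x - a * z))) ∂(gaussianReal 0 1) :=
        lintegral_lintegral_swap (by fun_prop)
    _ = ∫⁻ z, densityMeasure p (Prod.mk z ⁻¹' ((fun ω : ℝ × ℝ => ω.2 + a * ω.1) ⁻¹' s))
          ∂(gaussianReal 0 1) := by
        congr with z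
        have hshift := measurePreserving_add_right volume (a * z)
        rw [← hshift.setLIntegral_comp_preimage hs (by fun_prop), densityMeasure,
          withDensity_apply _ (measurable_prodMk_left (hadd hs))]
        simp only [add_sub_cancel_right, preimage_preimage]

lemma IsPositiveDensity.gaussianSmoothing (hp : IsPositiveDensity p) (a : ℝ) :
    IsPositiveDensity (gaussianSmoothing p 0 a) where
  pos x := by
    refine integral_pos_iff_support_of_nonneg (fun z => ?_)
      (integrable_pow_mul_comp_sub_mul hp.integrable 0 a x) |>.2 ?_
    · simpa using (hp.pos _).le
    · simp [Function.support, (hp.pos _).ne']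
  differentiable := differentiable_gaussianSmoothing hp.differentiable hp.integrable a
  integral_eq_one := by
    have := hp.isProbabilityMeasure
    have hlaw := densityMeasure_gaussianSmoothing (fun x => (hp.pos x).le)
      hp.continuous.measurable hp.integrable a
    have huniv : densityMeasure (ProbabilityFlow.gaussianSmoothing p 0 a) univ = 1 := by
      rw [hlaw, Measure.map_apply (by fun_prop) .univ, preimage_univ, measure_univ]
    rw [densityMeasure, withDensity_apply _ .univ, setLIntegral_univ] at huniv
    rw [integral_eq_lintegral_of_nonneg_ae, huniv, ENNReal.toReal_one]
    · exact ae_of_all _ fun x => integral_nonneg fun z => by simpa using (hp.pos _).le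
    · exact (differentiable_gaussianSmoothing hp.differentiable hp.integrable
        a).continuous.aestronglyMeasurable

/-- The distribution function of `X + a Z`, where `X` has density `p` and `Z ∼ N(0, 1)` is
independent of `X`. -/
noncomputable def smoothedCDF (p : ℝ → ℝ) (a x : ℝ) : ℝ :=
  ∫ u in Iic x, gaussianSmoothing p 0 a u

lemma smoothedCDF_eq_integral (hp : IsPositiveDensity p) (a x : ℝ) :
    smoothedCDF p a x = ∫ z, (∫ u in Iic (x - a * z), p u) ∂(gaussianReal 0 1) := by
  have := hp.isProbabilityMeasure
  have hadd : Measurable fun ω : ℝ × ℝ => ω.2 + a * ω.1 := by fun_prop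
  have hsection (z : ℝ) :
      Prod.mk z ⁻¹' ((fun ω : ℝ × ℝ => ω.2 + a * ω.1) ⁻¹' Iic x) = Iic (x - a * z) := by
    ext y; simp [le_sub_iff_add_le]
  rw [smoothedCDF, ← (hp.gaussianSmoothing a).densityMeasure_real_Iic, measureReal_def,
    densityMeasure_gaussianSmoothing (fun x => (hp.pos x).le) hp.continuous.measurable
      hp.integrable, Measure.map_apply hadd measurableSet_Iic,
    Measure.prod_apply (hadd measurableSet_Iic), ← integral_toReal
      (measurable_measure_prodMk_left (hadd measurableSet_Iic)).aemeasurable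
      (ae_of_all _ fun z => measure_lt_top _ _)]
  simp only [hsection, ← measureReal_def, hp.densityMeasure_real_Iic]

lemma integral_comp_sub_mul_eq_cdf_sub (hp : IsPositiveDensity p) (a₀ a x z : ℝ) :
    ∫ b in a₀..a, z * p (x - b * z)
      = (∫ u in Iic (x - a₀ * z), p u) - ∫ u in Iic (x - a * z), p u := by
  have hcont := hp.continuous
  have hderiv (b : ℝ) :
      HasDerivAt (fun b => ∫ u in Iic (x - b * z), p u) (-(z * p (x - b * z))) b := by
    have := (hp.hasDerivAt_cdf (x - b * z)).comp b
      (((hasDerivAt_id b).mul_const z).const_sub x)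
    exact this.congr_deriv (by ring)
  have hftc := intervalIntegral.integral_eq_sub_of_hasDerivAt (fun b _ => hderiv b)
    (Continuous.intervalIntegrable (by fun_prop) a₀ a)
  rw [intervalIntegral.integral_neg] at hftc
  linarith

lemma integrable_cdf_comp_sub_mul (hp : IsPositiveDensity p) (a x : ℝ) :
    Integrable (fun z => ∫ u in Iic (x - a * z), p u) (gaussianReal 0 1) :=
  Integrable.of_mem_Icc 0 1
    (hp.continuous_cdf.measurable.comp (by fun_prop : Measurable fun z => x - a * z)).aemeasurable
    (ae_of_all _ fun _ => Ioo_subset_Icc_self (hp.cdf_mem_Ioo _))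

/-- For fixed `z` the integral over `b` is at most `1`, being a difference of values of the
distribution function, so the density may be unbounded. -/
lemma integrable_mul_comp_sub_mul_prod (hp : IsPositiveDensity p) (a₀ a x : ℝ) :
    Integrable (Function.uncurry fun b z : ℝ => z ^ 1 * p (x - b * z))
      ((volume.restrict (uIoc a₀ a)).prod (gaussianReal 0 1)) := by
  have hcont := hp.continuous
  have hinner (z : ℝ) : ∫ b in uIoc a₀ a, ‖z ^ 1 * p (x - b * z)‖
      = ‖(∫ u in Iic (x - a₀ * z), p u) - ∫ u in Iic (x - a * z), p u‖ := by
    rw [← integral_comp_sub_mul_eq_cdf_sub hp, intervalIntegral.norm_intervalIntegral_eq,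
      integral_const_mul, norm_mul, Real.norm_of_nonneg (integral_nonneg fun b => (hp.pos _).le),
      ← integral_const_mul]
    simp only [pow_one, norm_mul, Real.norm_of_nonneg (hp.pos _).le]
  refine (integrable_prod_iff' (Continuous.aestronglyMeasurable (by fun_prop))).2
    ⟨ae_of_all _ fun z => ?_, ?_⟩
  · exact intervalIntegrable_iff.1 (Continuous.intervalIntegrable (by fun_prop) a₀ a)
  · simp only [Function.uncurry, hinner]
    exact ((integrable_cdf_comp_sub_mul hp a₀ x).sub (integrable_cdf_comp_sub_mul hp a x)).norm

lemma smoothedCDF_sub (hp : IsPositiveDensity p) (a₀ a x : ℝ) :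
    smoothedCDF p a₀ x - smoothedCDF p a x = ∫ b in a₀..a, gaussianSmoothing p 1 b x := by
  simp only [gaussianSmoothing]
  rw [intervalIntegral_integral_swap (integrable_mul_comp_sub_mul_prod hp a₀ a x)]
  simp only [pow_one, integral_comp_sub_mul_eq_cdf_sub hp]
  rw [integral_sub (integrable_cdf_comp_sub_mul hp a₀ x) (integrable_cdf_comp_sub_mul hp a x),
    smoothedCDF_eq_integral hp, smoothedCDF_eq_integral hp]

lemma hasDerivAt_smoothedCDF_space (hp : IsPositiveDensity p) (a x : ℝ) :
    HasDerivAt (smoothedCDF p a) (gaussianSmoothing p 0 a x) x :=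
  (hp.gaussianSmoothing a).hasDerivAt_cdf x

lemma hasDerivAt_smoothedCDF_noise (hp : IsPositiveDensity p) (a x : ℝ) :
    HasDerivAt (fun b => smoothedCDF p b x) (-gaussianSmoothing p 1 a x) a := by
  have hcont : Continuous fun b => gaussianSmoothing p 1 b x :=
    (continuous_gaussianSmoothing hp.continuous hp.integrable 1).comp (.prodMk_left x)
  refine ((hcont.integral_hasStrictDerivAt a a).hasDerivAt.const_sub
    (smoothedCDF p a x)).congr_of_eventuallyEq (.of_forall fun b => ?_)
  simp only [← smoothedCDF_sub hp, sub_sub_cancel]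

lemma hasStrictFDerivAt_smoothedCDF (hp : IsPositiveDensity p) (q : ℝ × ℝ) :
    HasStrictFDerivAt (fun q : ℝ × ℝ => smoothedCDF p q.1 q.2)
      ((ContinuousLinearMap.toSpanSingleton ℝ (-gaussianSmoothing p 1 q.1 q.2)).coprod
        (ContinuousLinearMap.toSpanSingleton ℝ (gaussianSmoothing p 0 q.1 q.2))) q := by
  have hcont (k : ℕ) := continuous_gaussianSmoothing hp.continuous hp.integrable k
  refine hasStrictFDerivAt_uncurry_coprod (f := smoothedCDF p)
    (f₁ := fun a x => .toSpanSingleton ℝ (-gaussianSmoothing p 1 a x))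
    (f₂ := fun a x => .toSpanSingleton ℝ (gaussianSmoothing p 0 a x))
    (.of_forall fun v => (hasDerivAt_smoothedCDF_noise hp v.1 v.2).hasFDerivAt)
    (.of_forall fun v => (hasDerivAt_smoothedCDF_space hp v.1 v.2).hasFDerivAt) ?_ ?_
  · exact ((ContinuousLinearMap.toSpanSingletonCLE (𝕜 := ℝ) (E := ℝ)).continuous.comp
      (hcont 1).neg).continuousAt
  · exact ((ContinuousLinearMap.toSpanSingletonCLE (𝕜 := ℝ) (E := ℝ)).continuous.comp
      (hcont 0)).continuousAt

/-- Conservation of mass: by the heat equation, the law of `X + a Z` is transported with velocity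
`-a ∂ₓ log q_a` as the noise level `a` varies. -/
lemma hasDerivWithinAt_smoothedCDF_comp (hp : IsPositiveDensity p) {r y : ℝ → ℝ} {r' y' t : ℝ}
    {s : Set ℝ} (hr : HasDerivWithinAt r r' s t) (hy : HasDerivWithinAt y y' s t) :
    HasDerivWithinAt (fun u => smoothedCDF p (r u) (y u))
      (gaussianSmoothing p 0 (r t) (y t)
        * (y' + r t * score (gaussianSmoothing p 0 (r t)) (y t) * r')) s t := by
  have hcomp := (hasStrictFDerivAt_smoothedCDF hp (r t, y t)).hasFDerivAt
    |>.comp_hasDerivWithinAt t (hr.prodMk hy)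
  refine hcomp.congr_deriv ?_
  have hstein := mul_deriv_gaussianSmoothing hp.integrable (r t) (y t)
  have hq := (hp.gaussianSmoothing (r t)).pos (y t)
  simp only [ContinuousLinearMap.coprod_apply, ContinuousLinearMap.toSpanSingleton_apply,
    smul_eq_mul, (hp.gaussianSmoothing (r t)).score_eq, ← hstein]
  field_simp
  ring

/-- The quantile function of `X + a Z` at the level `c`. -/
noncomputable def smoothedQuantile (p : ℝ → ℝ) (c a : ℝ) : ℝ :=
  Function.invFun (smoothedCDF p a) c

lemma smoothedCDF_smoothedQuantile (hp : IsPositiveDensity p) {c : ℝ} (hc : c ∈ Ioo (0 : ℝ) 1)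
    (a : ℝ) : smoothedCDF p a (smoothedQuantile p c a) = c :=
  Function.invFun_eq ((hp.gaussianSmoothing a).exists_cdf_eq hc)

lemma differentiableAt_smoothedQuantile (hp : IsPositiveDensity p) {c : ℝ}
    (hc : c ∈ Ioo (0 : ℝ) 1) (a : ℝ) : DifferentiableAt ℝ (smoothedQuantile p c) a := by
  set x := smoothedQuantile p c a
  have hH := hasStrictFDerivAt_smoothedCDF hp (a, x)
  have hinv : ((ContinuousLinearMap.toSpanSingleton ℝ (-gaussianSmoothing p 1 a x)).coprod
      (.toSpanSingleton ℝ (gaussianSmoothing p 0 a x)) ∘L .inr ℝ ℝ ℝ).IsInvertible := by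
    rw [ContinuousLinearMap.coprod_comp_inr]
    exact ⟨ContinuousLinearEquiv.unitsEquivAut ℝ (.mk0 _ ((hp.gaussianSmoothing a).pos x).ne'),
      by ext; simp⟩
  refine (hH.hasStrictFDerivAt_implicitFunctionOfProdDomain
    hinv).hasFDerivAt.differentiableAt.congr_of_eventuallyEq ?_
  filter_upwards [hH.eventually_apply_implicitFunctionOfProdDomain hinv] with b hb
  refine (hp.gaussianSmoothing b).strictMono_cdf.injective (Eq.trans ?_ hb.symm)
  exact (smoothedCDF_smoothedQuantile hp hc b).trans (smoothedCDF_smoothedQuantile hp hc a).symm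

lemma hasDerivAt_smoothedQuantile (hp : IsPositiveDensity p) {c : ℝ} (hc : c ∈ Ioo (0 : ℝ) 1)
    (a : ℝ) :
    HasDerivAt (smoothedQuantile p c)
      (-(a * score (gaussianSmoothing p 0 a) (smoothedQuantile p c a))) a := by
  have hQ := (differentiableAt_smoothedQuantile hp hc a).hasDerivAt
  have hH := hasDerivWithinAt_smoothedCDF_comp hp (s := univ) (hasDerivAt_id a).hasDerivWithinAt
    hQ.hasDerivWithinAt
  simp only [id, smoothedCDF_smoothedQuantile hp hc, mul_one, hasDerivWithinAt_univ] at hH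
  have hflux := hH.unique (hasDerivAt_const a c)
  have hq := ((hp.gaussianSmoothing a).pos (smoothedQuantile p c a)).ne'
  exact hQ.congr_deriv (eq_neg_of_add_eq_zero_left ((mul_eq_zero_iff_left hq).1 hflux))

lemma continuous_mul_score_gaussianSmoothing (hp : IsPositiveDensity p) :
    Continuous fun q : ℝ × ℝ => q.1 * score (gaussianSmoothing p 0 q.1) q.2 := by
  have hcont (k : ℕ) := continuous_gaussianSmoothing hp.continuous hp.integrable k
  refine ((hcont 1).neg.div (hcont 0) fun q => ((hp.gaussianSmoothing q.1).pos q.2).ne').congr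
    fun q => ?_
  rw [(hp.gaussianSmoothing q.1).score_eq, ← mul_div_assoc,
    mul_deriv_gaussianSmoothing hp.integrable]
  rfl

lemma contDiff_smoothedQuantile (hp : IsPositiveDensity p) {c : ℝ} (hc : c ∈ Ioo (0 : ℝ) 1) :
    ContDiff ℝ 1 (smoothedQuantile p c) := by
  have hdiff : Differentiable ℝ (smoothedQuantile p c) :=
    fun a => differentiableAt_smoothedQuantile hp hc a
  refine contDiff_one_iff_deriv.2 ⟨hdiff, ?_⟩
  simp only [funext fun a => (hasDerivAt_smoothedQuantile hp hc a).deriv]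
  exact ((continuous_mul_score_gaussianSmoothing hp).comp
    (continuous_id.prodMk hdiff.continuous)).neg

end

/-! ### The marginal laws -/

lemma isPositiveDensity_gaussianPDFReal : IsPositiveDensity (gaussianPDFReal 0 1) :=
  ⟨fun x => gaussianPDFReal_pos 0 1 x one_ne_zero,
    fun x => (hasDerivAt_gaussianPDFReal_zero_one x).differentiableAt,
    integral_gaussianPDFReal_eq_one 0 one_ne_zero⟩

lemma densityMeasure_gaussianPDFReal :
    densityMeasure (gaussianPDFReal 0 1) = gaussianReal 0 1 := by
  rw [gaussianReal_of_var_ne_zero 0 one_ne_zero]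
  rfl

lemma integral_Iic_inv_mul_comp_div (p : ℝ → ℝ) {c : ℝ} (hc : 0 < c) (x : ℝ) :
    (∫ u in Iic x, c⁻¹ * p (u / c)) = ∫ u in Iic (x / c), p u := by
  rw [integral_const_mul, ← integral_indicator measurableSet_Iic,
    ← integral_indicator measurableSet_Iic, inv_mul_eq_iff_eq_mul₀ hc.ne']
  have := Measure.integral_comp_div ((Iic (x / c)).indicator p) c
  rw [abs_of_pos hc, smul_eq_mul] at this
  rw [← this]
  congr with u
  simp only [indicator, mem_Iic, div_le_div_iff_of_pos_right hc]

namespace IsPositiveDensity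

variable {p : ℝ → ℝ} {c : ℝ}

lemma scale (hp : IsPositiveDensity p) (hc : 0 < c) :
    IsPositiveDensity (fun x => c⁻¹ * p (x / c)) where
  pos x := mul_pos (inv_pos.2 hc) (hp.pos _)
  differentiable := (hp.differentiable.comp (differentiable_id.div_const c)).const_mul _
  integral_eq_one := by
    rw [integral_const_mul, Measure.integral_comp_div p, hp.integral_eq_one, smul_eq_mul, mul_one,
      abs_of_pos hc, inv_mul_cancel₀ hc.ne']

lemma densityMeasure_scale (hp : IsPositiveDensity p) (hc : 0 < c) :
    densityMeasure (fun x => c⁻¹ * p (x / c)) = (densityMeasure p).map (c * ·) := by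
  have := (hp.scale hc).isProbabilityMeasure
  refine Measure.ext_of_Iic _ _ fun x => ?_
  have hpre : (c * ·) ⁻¹' Iic x = Iic (x / c) := by
    ext y; simp [le_div_iff₀ hc, mul_comm]
  rw [Measure.map_apply (by fun_prop) measurableSet_Iic, hpre,
    (hp.scale hc).densityMeasure_apply measurableSet_Iic, integral_Iic_inv_mul_comp_div p hc,
    hp.densityMeasure_apply measurableSet_Iic]

lemma score_scale (hp : IsPositiveDensity p) (hc : 0 < c) (x : ℝ) :
    score (fun x => c⁻¹ * p (x / c)) x = c⁻¹ * score p (x / c) := by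
  have hderiv : HasDerivAt (fun x => c⁻¹ * p (x / c)) (c⁻¹ * (deriv p (x / c) * (1 / c))) x :=
    ((hp.differentiable _).hasDerivAt.comp x ((hasDerivAt_id x).div_const c)).const_mul _
  rw [(hp.scale hc).score_eq, hp.score_eq, hderiv.deriv,
    mul_div_mul_left _ _ (inv_ne_zero hc.ne')]
  ring

end IsPositiveDensity

namespace IsSchedule

variable {α γ : ℝ → ℝ}

lemma γ_pos (h : IsSchedule α γ) {t : ℝ} (ht : t ∈ Ico (0 : ℝ) 1) : 0 < γ t := by
  have hne : ∀ s ∈ Icc 0 t, γ s ≠ 0 := fun s hs => by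
    obtain rfl | h0 := hs.1.eq_or_lt
    · rw [h.γ_zero]; exact one_ne_zero
    · exact h.γ_ne_zero s ⟨h0, hs.2.trans_lt ht.2⟩
  by_contra hneg
  have hc : ContinuousOn γ (Icc 0 t) :=
    h.contDiffOn_γ.continuousOn.mono (Icc_subset_Icc_right ht.2.le)
  obtain ⟨s, hs, hs0⟩ := intermediate_value_Icc' ht.1 hc
    (⟨not_lt.1 hneg, by rw [h.γ_zero]; exact zero_le_one⟩ : (0 : ℝ) ∈ Icc (γ t) (γ 0))
  exact hne s hs hs0

lemma hasDerivWithinAt_α (h : IsSchedule α γ) {t : ℝ} (ht : t ∈ Icc (0 : ℝ) 1) :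
    HasDerivWithinAt α (timeDeriv α t) (Icc 0 1) t :=
  (h.contDiffOn_α.differentiableOn one_ne_zero t ht).hasDerivWithinAt

lemma hasDerivWithinAt_γ (h : IsSchedule α γ) {t : ℝ} (ht : t ∈ Icc (0 : ℝ) 1) :
    HasDerivWithinAt γ (timeDeriv γ t) (Icc 0 1) t :=
  (h.contDiffOn_γ.differentiableOn one_ne_zero t ht).hasDerivWithinAt

lemma continuousOn_timeDeriv_α (h : IsSchedule α γ) : ContinuousOn (timeDeriv α) (Icc 0 1) :=
  h.contDiffOn_α.continuousOn_derivWithin (uniqueDiffOn_Icc zero_lt_one) le_rfl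

lemma continuousOn_timeDeriv_γ (h : IsSchedule α γ) : ContinuousOn (timeDeriv γ) (Icc 0 1) :=
  h.contDiffOn_γ.continuousOn_derivWithin (uniqueDiffOn_Icc zero_lt_one) le_rfl

end IsSchedule

/-- The ratio of noise to signal `α / γ`, which plays the role of time for the heat equation:
`x_t = γ(t) (x₀ + (α(t) / γ(t)) z)`. It is meaningful where `γ(t) ≠ 0`. -/
noncomputable def noiseRatio (α γ : ℝ → ℝ) (t : ℝ) : ℝ := α t / γ t

section

variable {p₀ α γ : ℝ → ℝ}

lemma marginalDensity_eq_gaussianSmoothing {t : ℝ} (hγ : 0 < γ t) :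
    marginalDensity p₀ α γ t
      = fun x => (γ t)⁻¹ * gaussianSmoothing p₀ 0 (noiseRatio α γ t) (x / γ t) := by
  ext x
  rw [marginalDensity, if_neg hγ.ne', gaussianSmoothing, integral_gaussianReal_zero_one,
    abs_of_pos hγ, ← integral_const_mul]
  congr with z
  rw [pow_zero, one_mul, noiseRatio, sub_div, div_mul_eq_mul_div]
  ring

lemma marginalDensity_zero (h : IsSchedule α γ) : marginalDensity p₀ α γ 0 = p₀ := by
  rw [marginalDensity_eq_gaussianSmoothing (h.γ_pos (left_mem_Ico.2 zero_lt_one)),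
    noiseRatio, h.α_zero, h.γ_zero, zero_div, gaussianSmoothing_zero_left]
  simp only [inv_one, one_mul, div_one]

lemma marginalDensity_one (h : IsSchedule α γ) :
    marginalDensity p₀ α γ 1 = gaussianPDFReal 0 1 := by
  have hvar : (⟨α 1 ^ 2, sq_nonneg (α 1)⟩ : NNReal) = 1 := by
    ext; simp [h.α_one]
  ext x
  rw [marginalDensity, if_pos h.γ_one, hvar]
  rfl

lemma isPositiveDensity_marginalDensity (hp : IsPositiveDensity p₀) (h : IsSchedule α γ) {t : ℝ}
    (ht : t ∈ Icc (0 : ℝ) 1) : IsPositiveDensity (marginalDensity p₀ α γ t) := by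
  obtain rfl | h1 := ht.2.eq_or_lt
  · rw [marginalDensity_one h]; exact isPositiveDensity_gaussianPDFReal
  · have hγ := h.γ_pos ⟨ht.1, h1⟩
    rw [marginalDensity_eq_gaussianSmoothing hγ]
    exact (hp.gaussianSmoothing _).scale hγ

lemma densityMeasure_marginalDensity (hp : IsPositiveDensity p₀) (h : IsSchedule α γ) {t : ℝ}
    (ht : t ∈ Icc (0 : ℝ) 1) :
    densityMeasure (marginalDensity p₀ α γ t)
      = ((gaussianReal 0 1).prod (densityMeasure p₀)).map
          (forwardProcess α γ Prod.fst Prod.snd t) := by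
  have := hp.isProbabilityMeasure
  obtain rfl | h1 := ht.2.eq_or_lt
  · have hfst : forwardProcess α γ Prod.fst Prod.snd 1 = (Prod.fst : ℝ × ℝ → ℝ) := by
      ext ω; simp [forwardProcess, h.α_one, h.γ_one]
    rw [marginalDensity_one h, densityMeasure_gaussianPDFReal, hfst, Measure.map_fst_prod,
      measure_univ, one_smul]
  · have hγ := h.γ_pos ⟨ht.1, h1⟩
    rw [marginalDensity_eq_gaussianSmoothing hγ, (hp.gaussianSmoothing _).densityMeasure_scale hγ,
      densityMeasure_gaussianSmoothing (fun x => (hp.pos x).le) hp.continuous.measurable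
        hp.integrable, Measure.map_map (by fun_prop) (by fun_prop)]
    congr with ω
    simp only [Function.comp_apply, noiseRatio, forwardProcess]
    field_simp
    ring

lemma marginalCDF_eq_smoothedCDF {t : ℝ} (hγ : 0 < γ t) (x : ℝ) :
    marginalCDF p₀ α γ t x = smoothedCDF p₀ (noiseRatio α γ t) (x / γ t) := by
  rw [marginalCDF, marginalDensity_eq_gaussianSmoothing hγ, integral_Iic_inv_mul_comp_div _ hγ,
    smoothedCDF]

lemma hasLaw_forwardProcess (hp : IsPositiveDensity p₀) (h : IsSchedule α γ)
    {Ω : Type*} [MeasurableSpace Ω] {P : Measure Ω} {z x₀ : Ω → ℝ}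
    (hz : HasLaw z (gaussianReal 0 1) P) (hx₀ : HasLaw x₀ (densityMeasure p₀) P)
    (hindep : IndepFun z x₀ P) {t : ℝ} (ht : t ∈ Icc (0 : ℝ) 1) :
    HasLaw (forwardProcess α γ z x₀ t) (densityMeasure (marginalDensity p₀ α γ t)) P := by
  have := hz.isProbabilityMeasure
  have hcanonical : HasLaw (forwardProcess α γ Prod.fst Prod.snd t)
      (densityMeasure (marginalDensity p₀ α γ t)) ((gaussianReal 0 1).prod (densityMeasure p₀)) :=
    ⟨by unfold forwardProcess; fun_prop, (densityMeasure_marginalDensity hp h ht).symm⟩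
  exact hcanonical.comp (hindep.hasLaw_prod hz hx₀)

end

/-! ### The backward flow before the terminal time -/

lemma tendsto_measureReal_le_of_tendsto_ae {Ω ι : Type*} [MeasurableSpace Ω] {μ : Measure Ω}
    [IsFiniteMeasure μ] {l : Filter ι} [l.IsCountablyGenerated] {X : ι → Ω → ℝ} {Y : Ω → ℝ}
    (hX : ∀ i, Measurable (X i)) (hY : Measurable Y) {y : ι → ℝ} {b : ℝ}
    (hXY : ∀ᵐ ω ∂μ, Tendsto (fun i => X i ω) l (𝓝 (Y ω))) (hy : Tendsto y l (𝓝 b))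
    (hb : ∀ᵐ ω ∂μ, Y ω ≠ b) :
    Tendsto (fun i => μ.real {ω | X i ω ≤ y i}) l (𝓝 (μ.real {ω | Y ω ≤ b})) := by
  refine (ENNReal.tendsto_toReal (measure_ne_top μ _)).comp
    (tendsto_measure_of_ae_tendsto_indicator_of_isFiniteMeasure l
      (measurableSet_le hY measurable_const) (fun i => measurableSet_le (hX i) measurable_const) ?_)
  filter_upwards [hXY, hb] with ω hω hne
  obtain hlt | hgt := hne.lt_or_gt
  · filter_upwards [hω.eventually_lt hy hlt] with i hi
    exact iff_of_true hi.le hlt.le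
  · filter_upwards [hy.eventually_lt hω hgt] with i hi
    exact iff_of_false hi.not_ge hgt.not_ge

lemma tendsto_of_strictMono_of_tendsto {ι : Type*} {l : Filter ι} {F : ι → ℝ → ℝ} {G : ℝ → ℝ}
    {y : ι → ℝ} {b : ℝ} (hF : ∀ᶠ i in l, StrictMono (F i)) (hG : StrictMono G)
    (hlim : ∀ a, Tendsto (fun i => F i a) l (𝓝 (G a))) (hy : ∀ᶠ i in l, F i (y i) = G b) :
    Tendsto y l (𝓝 b) := by
  refine tendsto_order.2 ⟨fun a ha => ?_, fun a ha => ?_⟩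
  · filter_upwards [(hlim a).eventually_lt_const (hG ha), hF, hy] with i hi hmono hyi
    rwa [← hyi, hmono.lt_iff_lt] at hi
  · filter_upwards [(hlim a).eventually_const_lt (hG ha), hF, hy] with i hi hmono hyi
    rwa [← hyi, hmono.lt_iff_lt] at hi

lemma Ico_mem_nhdsWithin_Icc (a : ℝ) {b t : ℝ} (ht : t < b) : Ico a b ∈ 𝓝[Icc a b] t :=
  mem_of_superset (inter_mem_nhdsWithin _ (Iio_mem_nhds ht)) fun _ hs => ⟨hs.1.1, hs.2⟩

/-- The backward flow `x_t(x₁) = F_t⁻¹(F_1(x₁))`. -/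
noncomputable def backwardFlow (p₀ α γ : ℝ → ℝ) (x₁ t : ℝ) : ℝ :=
  Function.invFun (marginalCDF p₀ α γ t) (marginalCDF p₀ α γ 1 x₁)

section

variable {p₀ α γ : ℝ → ℝ}

lemma marginalCDF_eq_measureReal (hp : IsPositiveDensity p₀) (h : IsSchedule α γ) {t : ℝ}
    (ht : t ∈ Icc (0 : ℝ) 1) (x : ℝ) :
    marginalCDF p₀ α γ t x
      = ((gaussianReal 0 1).prod (densityMeasure p₀)).real
          {ω | forwardProcess α γ Prod.fst Prod.snd t ω ≤ x} := by
  rw [marginalCDF, ← (isPositiveDensity_marginalDensity hp h ht).densityMeasure_real_Iic,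
    densityMeasure_marginalDensity hp h ht,
    map_measureReal_apply (by unfold forwardProcess; fun_prop) measurableSet_Iic]
  rfl

lemma tendsto_marginalCDF (hp : IsPositiveDensity p₀) (h : IsSchedule α γ) {t x : ℝ}
    (ht : t ∈ Icc (0 : ℝ) 1) {ι : Type*} {l : Filter ι} [l.IsCountablyGenerated] {s y : ι → ℝ}
    (hs : Tendsto s l (𝓝[Icc 0 1] t)) (hy : Tendsto y l (𝓝 x)) :
    Tendsto (fun i => marginalCDF p₀ α γ (s i) (y i)) l (𝓝 (marginalCDF p₀ α γ t x)) := by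
  have := hp.isProbabilityMeasure
  have hmeas (s : ℝ) : Measurable (forwardProcess α γ Prod.fst (Prod.snd : ℝ × ℝ → ℝ) s) := by
    unfold forwardProcess; fun_prop
  have hnoAtom : ∀ᵐ ω ∂(gaussianReal 0 1).prod (densityMeasure p₀),
      forwardProcess α γ Prod.fst Prod.snd t ω ≠ x := by
    rw [← ae_map_iff (p := (· ≠ x)) (hmeas t).aemeasurable (measurableSet_singleton x).compl,
      ← densityMeasure_marginalDensity hp h ht]
    exact compl_mem_ae_iff.2 (densityMeasure_singleton _ x)
  rw [marginalCDF_eq_measureReal hp h ht]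
  refine (tendsto_measureReal_le_of_tendsto_ae (fun i => hmeas (s i)) (hmeas t)
    (ae_of_all _ fun ω => ?_) hy hnoAtom).congr' ?_
  · exact (((h.contDiffOn_α.continuousOn t ht).tendsto.comp hs).mul_const _).add
      (((h.contDiffOn_γ.continuousOn t ht).tendsto.comp hs).mul_const _)
  · filter_upwards [hs.eventually eventually_mem_nhdsWithin] with i hi
    exact (marginalCDF_eq_measureReal hp h hi _).symm

lemma strictMono_marginalCDF (hp : IsPositiveDensity p₀) (h : IsSchedule α γ) {t : ℝ}
    (ht : t ∈ Icc (0 : ℝ) 1) : StrictMono (marginalCDF p₀ α γ t) :=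
  (isPositiveDensity_marginalDensity hp h ht).strictMono_cdf

lemma bijOn_marginalCDF (hp : IsPositiveDensity p₀) (h : IsSchedule α γ) {t : ℝ}
    (ht : t ∈ Icc (0 : ℝ) 1) : BijOn (marginalCDF p₀ α γ t) univ (Ioo 0 1) :=
  (isPositiveDensity_marginalDensity hp h ht).bijOn_cdf

lemma marginalCDF_one_mem_Ioo (h : IsSchedule α γ) (x : ℝ) :
    marginalCDF p₀ α γ 1 x ∈ Ioo (0 : ℝ) 1 := by
  rw [marginalCDF, marginalDensity_one h]
  exact isPositiveDensity_gaussianPDFReal.cdf_mem_Ioo x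

lemma marginalCDF_backwardFlow (hp : IsPositiveDensity p₀) (h : IsSchedule α γ) (x₁ : ℝ) {t : ℝ}
    (ht : t ∈ Icc (0 : ℝ) 1) :
    marginalCDF p₀ α γ t (backwardFlow p₀ α γ x₁ t) = marginalCDF p₀ α γ 1 x₁ :=
  Function.invFun_eq ((isPositiveDensity_marginalDensity hp h ht).exists_cdf_eq
    (marginalCDF_one_mem_Ioo h x₁))

lemma backwardFlow_one (hp : IsPositiveDensity p₀) (h : IsSchedule α γ) (x₁ : ℝ) :
    backwardFlow p₀ α γ x₁ 1 = x₁ :=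
  Function.leftInverse_invFun
    (strictMono_marginalCDF hp h (right_mem_Icc.2 zero_le_one)).injective x₁

lemma strictMono_backwardFlow (hp : IsPositiveDensity p₀) (h : IsSchedule α γ) {t : ℝ}
    (ht : t ∈ Icc (0 : ℝ) 1) : StrictMono (fun x₁ => backwardFlow p₀ α γ x₁ t) := fun x y hxy => by
  rw [← (strictMono_marginalCDF hp h ht).lt_iff_lt, marginalCDF_backwardFlow hp h x ht,
    marginalCDF_backwardFlow hp h y ht]
  exact strictMono_marginalCDF hp h (right_mem_Icc.2 zero_le_one) hxy

lemma continuousOn_backwardFlow (hp : IsPositiveDensity p₀) (h : IsSchedule α γ) (x₁ : ℝ) :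
    ContinuousOn (backwardFlow p₀ α γ x₁) (Icc 0 1) := fun t ht =>
  tendsto_of_strictMono_of_tendsto (F := marginalCDF p₀ α γ) (G := marginalCDF p₀ α γ t)
    (eventually_mem_nhdsWithin.mono fun _ hs => strictMono_marginalCDF hp h hs)
    (strictMono_marginalCDF hp h ht)
    (fun _ => tendsto_marginalCDF hp h ht tendsto_id tendsto_const_nhds)
    (eventually_mem_nhdsWithin.mono fun s hs => by
      rw [marginalCDF_backwardFlow hp h x₁ hs, marginalCDF_backwardFlow hp h x₁ ht])

lemma backwardFlow_eq_smoothedQuantile (hp : IsPositiveDensity p₀) (h : IsSchedule α γ)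
    (x₁ : ℝ) {t : ℝ} (ht : t ∈ Ico (0 : ℝ) 1) :
    backwardFlow p₀ α γ x₁ t
      = γ t * smoothedQuantile p₀ (marginalCDF p₀ α γ 1 x₁) (noiseRatio α γ t) := by
  have hγ := h.γ_pos ht
  have ht' := Ico_subset_Icc_self ht
  refine (strictMono_marginalCDF hp h ht').injective ?_
  rw [marginalCDF_backwardFlow hp h x₁ ht', marginalCDF_eq_smoothedCDF hγ,
    mul_div_cancel_left₀ _ hγ.ne', smoothedCDF_smoothedQuantile hp (marginalCDF_one_mem_Ioo h x₁)]

lemma hasDerivWithinAt_noiseRatio (h : IsSchedule α γ) {t : ℝ} (ht : t ∈ Ico (0 : ℝ) 1) :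
    HasDerivWithinAt (noiseRatio α γ)
      ((timeDeriv α t * γ t - α t * timeDeriv γ t) / γ t ^ 2) (Icc 0 1) t :=
  (h.hasDerivWithinAt_α (Ico_subset_Icc_self ht)).div
    (h.hasDerivWithinAt_γ (Ico_subset_Icc_self ht)) (h.γ_pos ht).ne'

/-- Seen in the coordinate `x / γ(t)`, the velocity is transport by the score at the rate
`r r'`, where `r` is the noise ratio. -/
lemma velocity_eq_score_gaussianSmoothing (hp : IsPositiveDensity p₀) {t : ℝ} (hγ : 0 < γ t)
    (x : ℝ) :
    velocity p₀ α γ x t = timeDeriv γ t * (x / γ t)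
      - γ t * (noiseRatio α γ t
        * score (gaussianSmoothing p₀ 0 (noiseRatio α γ t)) (x / γ t)
        * ((timeDeriv α t * γ t - α t * timeDeriv γ t) / γ t ^ 2)) := by
  rw [velocity, marginalDensity_eq_gaussianSmoothing hγ,
    (hp.gaussianSmoothing _).score_scale hγ, noiseRatio]
  field_simp

lemma hasDerivWithinAt_backwardFlow (hp : IsPositiveDensity p₀) (h : IsSchedule α γ) (x₁ : ℝ)
    {t : ℝ} (ht : t ∈ Ico (0 : ℝ) 1) :
    HasDerivWithinAt (backwardFlow p₀ α γ x₁)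
      (velocity p₀ α γ (backwardFlow p₀ α γ x₁ t) t) (Icc 0 1) t := by
  have hγ := h.γ_pos ht
  have hprod := (h.hasDerivWithinAt_γ (Ico_subset_Icc_self ht)).mul
    ((hasDerivAt_smoothedQuantile hp (marginalCDF_one_mem_Ioo (p₀ := p₀) h x₁)
      (noiseRatio α γ t)).comp_hasDerivWithinAt t (hasDerivWithinAt_noiseRatio h ht))
  have hflow := fun s hs => backwardFlow_eq_smoothedQuantile (t := s) hp h x₁ hs
  refine (hprod.congr_of_eventuallyEq ?_ (hflow t ht)).congr_deriv ?_
  · filter_upwards [Ico_mem_nhdsWithin_Icc 0 ht.2] with s hs using hflow s hs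
  · rw [velocity_eq_score_gaussianSmoothing hp hγ, hflow t ht, mul_div_cancel_left₀ _ hγ.ne',
      Function.comp_apply]
    ring

lemma isBackwardSolution_backwardFlow (hp : IsPositiveDensity p₀) (h : IsSchedule α γ) (x₁ : ℝ) :
    IsBackwardSolution p₀ α γ x₁ (backwardFlow p₀ α γ x₁) :=
  ⟨continuousOn_backwardFlow hp h x₁, backwardFlow_one hp h x₁,
    fun _ ht => hasDerivWithinAt_backwardFlow hp h x₁ ht⟩

lemma contDiffOn_backwardFlow_Ico (hp : IsPositiveDensity p₀) (h : IsSchedule α γ) (x₁ : ℝ) :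
    ContDiffOn ℝ 1 (backwardFlow p₀ α γ x₁) (Ico 0 1) := by
  have hα := h.contDiffOn_α.mono Ico_subset_Icc_self
  have hγ := h.contDiffOn_γ.mono Ico_subset_Icc_self
  exact (hγ.mul ((contDiff_smoothedQuantile hp (marginalCDF_one_mem_Ioo h x₁)).comp_contDiffOn
    (hα.div hγ fun t ht => (h.γ_pos ht).ne'))).congr fun t ht =>
      backwardFlow_eq_smoothedQuantile hp h x₁ ht

lemma hasDerivWithinAt_marginalCDF_of_velocity (hp : IsPositiveDensity p₀) (h : IsSchedule α γ)
    {y : ℝ → ℝ} {t : ℝ} (ht : t ∈ Ico (0 : ℝ) 1)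
    (hy : HasDerivWithinAt y (velocity p₀ α γ (y t) t) (Icc 0 1) t) :
    HasDerivWithinAt (fun s => marginalCDF p₀ α γ s (y s)) 0 (Icc 0 1) t := by
  have hγ := h.γ_pos ht
  have hcdf := hasDerivWithinAt_smoothedCDF_comp hp (hasDerivWithinAt_noiseRatio h ht)
    (hy.div (h.hasDerivWithinAt_γ (Ico_subset_Icc_self ht)) hγ.ne')
  refine (hcdf.congr_of_eventuallyEq ?_ (marginalCDF_eq_smoothedCDF hγ _)).congr_deriv ?_
  · filter_upwards [Ico_mem_nhdsWithin_Icc 0 ht.2] with s hs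
      using marginalCDF_eq_smoothedCDF (h.γ_pos hs) _
  · rw [velocity_eq_score_gaussianSmoothing hp hγ, Pi.div_apply]
    refine mul_eq_zero_of_right _ ?_
    field_simp
    ring

lemma marginalCDF_eq_of_isBackwardSolution (hp : IsPositiveDensity p₀) (h : IsSchedule α γ)
    {x₁ : ℝ} {y : ℝ → ℝ} (hy : IsBackwardSolution p₀ α γ x₁ y) {t : ℝ}
    (ht : t ∈ Icc (0 : ℝ) 1) : marginalCDF p₀ α γ t (y t) = marginalCDF p₀ α γ 1 x₁ := by
  have hconst := constant_of_has_deriv_right_zero (f := fun s => marginalCDF p₀ α γ s (y s))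
    (fun s hs => tendsto_marginalCDF hp h hs tendsto_id (hy.continuousOn s hs)) fun s hs =>
      (hasDerivWithinAt_marginalCDF_of_velocity hp h hs
        (hy.hasDerivWithinAt s hs)).mono_of_mem_nhdsWithin (Icc_mem_nhdsGE_of_mem hs)
  rw [hconst t ht, ← hconst 1 (right_mem_Icc.2 zero_le_one), hy.terminal]

lemma eqOn_backwardFlow (hp : IsPositiveDensity p₀) (h : IsSchedule α γ) {x₁ : ℝ} {y : ℝ → ℝ}
    (hy : IsBackwardSolution p₀ α γ x₁ y) : EqOn y (backwardFlow p₀ α γ x₁) (Icc 0 1) :=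
  fun t ht => (strictMono_marginalCDF hp h ht).injective <| by
    rw [marginalCDF_eq_of_isBackwardSolution hp h hy ht, marginalCDF_backwardFlow hp h x₁ ht]

end

/-! ### The terminal time -/

lemma gaussianPDFReal_zero_one_le (z : ℝ) : gaussianPDFReal 0 1 z ≤ Real.exp 2⁻¹ := by
  simpa using abs_pow_mul_gaussianPDFReal_le 0 z

lemma integrable_gaussianPDFReal_mul {f : ℝ → ℝ} (hf : Integrable f) (a c x : ℝ) :
    Integrable fun y => gaussianPDFReal 0 1 ((x - c * y) / a) * f y :=
  hf.bdd_mul (c := Real.exp 2⁻¹)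
    ((measurable_gaussianPDFReal 0 1).comp (by fun_prop)).aestronglyMeasurable
    (ae_of_all _ fun y => by
      rw [Real.norm_of_nonneg (gaussianPDFReal_nonneg 0 1 _)]
      exact gaussianPDFReal_zero_one_le _)

lemma continuousAt_integral_gaussianPDFReal_mul {f : ℝ → ℝ} (hf : Integrable f) {a : ℝ}
    (ha : a ≠ 0) (c x : ℝ) :
    ContinuousAt (fun q : ℝ × ℝ × ℝ =>
      ∫ y, gaussianPDFReal 0 1 ((q.2.2 - q.2.1 * y) / q.1) * f y) (a, c, x) := by
  refine continuousAt_of_dominated (bound := fun y => Real.exp 2⁻¹ * |f y|)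
    (.of_forall fun q => (integrable_gaussianPDFReal_mul hf _ _ _).aestronglyMeasurable)
    (.of_forall fun q => ae_of_all _ fun y => ?_) (hf.abs.const_mul _) (ae_of_all _ fun y => ?_)
  · rw [norm_mul, Real.norm_of_nonneg (gaussianPDFReal_nonneg 0 1 _), Real.norm_eq_abs]
    exact mul_le_mul_of_nonneg_right (gaussianPDFReal_zero_one_le _) (abs_nonneg _)
  · refine ContinuousAt.mul (ContinuousAt.comp' (g := gaussianPDFReal 0 1)
      (continuous_gaussianPDFReal 0 1).continuousAt ?_) continuousAt_const
    exact ContinuousAt.div (by fun_prop) (by fun_prop) ha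

/-- The conditional expectation `E[X | a Z + c X = x]`, where `X` has density `p` and
`Z ∼ N(0, 1)` is independent of `X`, given by Bayes' formula. It is meaningful for `a ≠ 0`. -/
noncomputable def posteriorMean (p : ℝ → ℝ) (a c x : ℝ) : ℝ :=
  (∫ y, gaussianPDFReal 0 1 ((x - c * y) / a) * (y * p y))
    / ∫ y, gaussianPDFReal 0 1 ((x - c * y) / a) * p y

section

variable {p : ℝ → ℝ}

lemma integral_gaussianPDFReal_mul_pos (hp : IsPositiveDensity p) (a c x : ℝ) :
    0 < ∫ y, gaussianPDFReal 0 1 ((x - c * y) / a) * p y := by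
  have hpos (y : ℝ) : 0 < gaussianPDFReal 0 1 ((x - c * y) / a) * p y :=
    mul_pos (gaussianPDFReal_pos 0 1 _ one_ne_zero) (hp.pos y)
  rw [integral_pos_iff_support_of_nonneg (fun y => (hpos y).le)
    (integrable_gaussianPDFReal_mul hp.integrable a c x)]
  simp [Function.support, fun y => (hpos y).ne']

lemma continuousAt_posteriorMean (hp : IsPositiveDensity p) (hpint : Integrable fun x => x * p x)
    {a : ℝ} (ha : a ≠ 0) (c x : ℝ) :
    ContinuousAt (fun q : ℝ × ℝ × ℝ => posteriorMean p q.1 q.2.1 q.2.2) (a, c, x) :=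
  (continuousAt_integral_gaussianPDFReal_mul hpint ha c x).div
    (continuousAt_integral_gaussianPDFReal_mul hp.integrable ha c x)
    (integral_gaussianPDFReal_mul_pos hp a c x).ne'

lemma posteriorMean_zero (hp : IsPositiveDensity p) (a x : ℝ) :
    posteriorMean p a 0 x = ∫ y, y * p y := by
  simp only [posteriorMean, zero_mul, sub_zero, integral_const_mul, hp.integral_eq_one, mul_one]
  exact mul_div_cancel_left₀ _ (gaussianPDFReal_pos 0 1 _ one_ne_zero).ne'

/-- Tweedie's formula. -/
lemma mul_score_gaussianSmoothing (hp : IsPositiveDensity p)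
    (hpint : Integrable fun x => x * p x) {a c : ℝ} (ha : 0 < a) (hc : 0 < c) (x : ℝ) :
    a / c * score (gaussianSmoothing p 0 (a / c)) (x / c)
      = -((x - c * posteriorMean p a c x) / a) := by
  have hkernel (k : ℕ) : gaussianSmoothing p k (a / c) (x / c)
      = |a / c|⁻¹ * ∫ y, ((x - c * y) / a) ^ k
          * gaussianPDFReal 0 1 ((x - c * y) / a) * p y := by
    have harg (y : ℝ) : (x / c - y) / (a / c) = (x - c * y) / a := by field_simp
    simp only [gaussianSmoothing_eq_integral_kernel p k (div_pos ha hc).ne', harg]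
  have hfirst : ∫ y, ((x - c * y) / a) ^ 1 * gaussianPDFReal 0 1 ((x - c * y) / a) * p y
      = (x / a) * (∫ y, gaussianPDFReal 0 1 ((x - c * y) / a) * p y)
        - (c / a) * ∫ y, gaussianPDFReal 0 1 ((x - c * y) / a) * (y * p y) := by
    rw [← integral_const_mul, ← integral_const_mul, ← integral_sub
      ((integrable_gaussianPDFReal_mul hp.integrable a c x).const_mul _)
      ((integrable_gaussianPDFReal_mul hpint a c x).const_mul _)]
    congr with y
    ring
  have hpos := (integral_gaussianPDFReal_mul_pos hp a c x).ne'
  have habs : |a / c|⁻¹ ≠ 0 := inv_ne_zero (abs_pos.2 (div_pos ha hc).ne').ne'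
  rw [(hp.gaussianSmoothing _).score_eq, ← mul_div_assoc,
    mul_deriv_gaussianSmoothing hp.integrable, hkernel, hkernel, hfirst, neg_div,
    mul_div_mul_left _ _ habs, posteriorMean]
  simp only [pow_zero, one_mul]
  field_simp

end

lemma contDiffOn_Icc_of_tendsto_deriv {E : Type*} [NormedAddCommGroup E] [NormedSpace ℝ E]
    {f : ℝ → E} {a b : ℝ} {e : E} (hab : a < b) (hf : ContDiffOn ℝ 1 f (Ico a b))
    (hderiv_b : HasDerivWithinAt f e (Icc a b) b) (hlim : Tendsto (deriv f) (𝓝[<] b) (𝓝 e)) :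
    ContDiffOn ℝ 1 f (Icc a b) := by
  have hdiff := hf.differentiableOn one_ne_zero
  have huniq := uniqueDiffOn_Icc hab
  refine (contDiffOn_one_iff_derivWithin huniq).2 ⟨fun t ht => ?_, fun t ht => ?_⟩
  · obtain rfl | hlt := ht.2.eq_or_lt
    · exact hderiv_b.differentiableWithinAt
    · exact (hdiff t ⟨ht.1, hlt⟩).mono_of_mem_nhdsWithin (Ico_mem_nhdsWithin_Icc a hlt)
  · obtain rfl | hlt := ht.2.eq_or_lt
    · rw [← Ico_insert_right hab.le, continuousWithinAt_insert_self, Ico_insert_right hab.le,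
        ContinuousWithinAt, hderiv_b.derivWithin (huniq t ht), nhdsWithin_Ico_eq_nhdsLT hab]
      refine hlim.congr' ?_
      filter_upwards [Ioo_mem_nhdsLT hab] with s hs
      exact (derivWithin_of_mem_nhds (Icc_mem_nhds hs.1 hs.2)).symm
    · have hcont := hf.continuousOn_derivWithin (uniqueDiffOn_Ico a b) le_rfl t ⟨ht.1, hlt⟩
      refine ((hcont.congr_of_mem (fun s hs => ?_) ⟨ht.1, hlt⟩).mono_of_mem_nhdsWithin
        (Ico_mem_nhdsWithin_Icc a hlt))
      exact derivWithin_of_mem_nhdsWithin (Ico_mem_nhdsWithin_Icc a hs.2)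
        (huniq s (Ico_subset_Icc_self hs)) (hdiff s hs)

section

variable {p₀ α γ : ℝ → ℝ}

lemma velocity_eq_posteriorMean (hp : IsPositiveDensity p₀)
    (hpint : Integrable fun x => x * p₀ x) {t : ℝ} (hα : 0 < α t) (hγ : 0 < γ t) (x : ℝ) :
    velocity p₀ α γ x t = timeDeriv α t / α t * x
      + (timeDeriv γ t - timeDeriv α t * γ t / α t) * posteriorMean p₀ (α t) (γ t) x := by
  rw [velocity_eq_score_gaussianSmoothing hp hγ, noiseRatio,
    mul_score_gaussianSmoothing hp hpint hα hγ]
  field_simp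
  ring

lemma tendsto_velocity_one (hp : IsPositiveDensity p₀) (h : IsSchedule α γ)
    (hpint : Integrable fun x => x * p₀ x) {x : ℝ} {ι : Type*} {l : Filter ι} {s y : ι → ℝ}
    (hs : Tendsto s l (𝓝[Ico 0 1] 1)) (hy : Tendsto y l (𝓝 x)) :
    Tendsto (fun i => velocity p₀ α γ (y i) (s i)) l
      (𝓝 (timeDeriv α 1 * x + timeDeriv γ 1 * ∫ x, x * p₀ x)) := by
  have h1 : (1 : ℝ) ∈ Icc (0 : ℝ) 1 := right_mem_Icc.2 zero_le_one
  have hs' : Tendsto s l (𝓝[Icc 0 1] 1) := hs.mono_right (nhdsWithin_mono _ Ico_subset_Icc_self)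
  have hα := (h.contDiffOn_α.continuousOn 1 h1).tendsto.comp hs'
  have hγ := (h.contDiffOn_γ.continuousOn 1 h1).tendsto.comp hs'
  have hα' := (h.continuousOn_timeDeriv_α 1 h1).tendsto.comp hs'
  have hγ' := (h.continuousOn_timeDeriv_γ 1 h1).tendsto.comp hs'
  rw [h.α_one] at hα
  rw [h.γ_one] at hγ
  have hmean := (continuousAt_posteriorMean hp hpint one_ne_zero 0 x).tendsto.comp
    (hα.prodMk_nhds (hγ.prodMk_nhds hy))
  rw [posteriorMean_zero hp] at hmean
  have hlim := ((hα'.div hα one_ne_zero).mul hy).add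
    ((hγ'.sub ((hα'.mul hγ).div hα one_ne_zero)).mul hmean)
  simp only [div_one, mul_zero, sub_zero] at hlim
  refine hlim.congr' ?_
  filter_upwards [hα.eventually_const_lt zero_lt_one, hs.eventually eventually_mem_nhdsWithin]
    with i hαi hi
  exact (velocity_eq_posteriorMean hp hpint hαi (h.γ_pos hi) _).symm

lemma tendsto_deriv_backwardFlow_one (hp : IsPositiveDensity p₀) (h : IsSchedule α γ)
    (hpint : Integrable fun x => x * p₀ x) (x₁ : ℝ) :
    Tendsto (deriv (backwardFlow p₀ α γ x₁)) (𝓝[<] 1)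
      (𝓝 (timeDeriv α 1 * x₁ + timeDeriv γ 1 * ∫ x, x * p₀ x)) := by
  have hIco : 𝓝[<] (1 : ℝ) = 𝓝[Ico 0 1] 1 := (nhdsWithin_Ico_eq_nhdsLT zero_lt_one).symm
  have hflow : Tendsto (backwardFlow p₀ α γ x₁) (𝓝[<] 1) (𝓝 x₁) := by
    have := continuousOn_backwardFlow hp h x₁ 1 (right_mem_Icc.2 zero_le_one)
    rw [ContinuousWithinAt, backwardFlow_one hp h] at this
    exact this.mono_left (hIco.trans_le (nhdsWithin_mono _ Ico_subset_Icc_self))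
  refine (tendsto_velocity_one hp h hpint (tendsto_id.mono_left hIco.le) hflow).congr' ?_
  filter_upwards [Ioo_mem_nhdsLT zero_lt_one] with s hs
  exact ((hasDerivWithinAt_backwardFlow hp h x₁ (Ioo_subset_Ico_self hs)).hasDerivAt
    (Icc_mem_nhds hs.1 hs.2)).deriv.symm

lemma hasDerivWithinAt_backwardFlow_one (hp : IsPositiveDensity p₀) (h : IsSchedule α γ)
    (hpint : Integrable fun x => x * p₀ x) (x₁ : ℝ) :
    HasDerivWithinAt (backwardFlow p₀ α γ x₁)
      (timeDeriv α 1 * x₁ + timeDeriv γ 1 * ∫ x, x * p₀ x) (Icc 0 1) 1 :=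
  (hasDerivWithinAt_Iic_of_tendsto_deriv
    (((contDiffOn_backwardFlow_Ico hp h x₁).differentiableOn one_ne_zero).mono
      Ioo_subset_Ico_self)
    ((continuousOn_backwardFlow hp h x₁ 1 (right_mem_Icc.2 zero_le_one)).mono Ioo_subset_Icc_self)
    (Ioo_mem_nhdsLT zero_lt_one)
    (tendsto_deriv_backwardFlow_one hp h hpint x₁)).mono Icc_subset_Iic_self

lemma contDiffOn_backwardFlow_Icc (hp : IsPositiveDensity p₀) (h : IsSchedule α γ)
    (hpint : Integrable fun x => x * p₀ x) (x₁ : ℝ) :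
    ContDiffOn ℝ 1 (backwardFlow p₀ α γ x₁) (Icc 0 1) :=
  contDiffOn_Icc_of_tendsto_deriv zero_lt_one (contDiffOn_backwardFlow_Ico hp h x₁)
    (hasDerivWithinAt_backwardFlow_one hp h hpint x₁)
    (tendsto_deriv_backwardFlow_one hp h hpint x₁)

end

/-! ### Monotone transport -/

lemma map_eq_densityMeasure_of_cdf_eq {p q : ℝ → ℝ} (hp : IsPositiveDensity p)
    (hq : IsPositiveDensity q) {g : ℝ → ℝ}
    (hg : ∀ x, (∫ u in Iic (g x), q u) = ∫ u in Iic x, p u) :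
    (densityMeasure p).map g = densityMeasure q := by
  have := hp.isProbabilityMeasure
  have hmono : Monotone g := fun x y hxy => by
    rw [← hq.strictMono_cdf.le_iff_le]
    simpa only [hg] using hp.strictMono_cdf.monotone hxy
  have := Measure.isProbabilityMeasure_map (μ := densityMeasure p) hmono.measurable.aemeasurable
  refine Measure.ext_of_Iic _ _ fun a => ?_
  obtain ⟨b, hb⟩ := hp.exists_cdf_eq (hq.cdf_mem_Ioo a)
  have hpre : g ⁻¹' Iic a = Iic b := by
    ext x
    rw [mem_preimage, mem_Iic, mem_Iic, ← hq.strictMono_cdf.le_iff_le (a := g x),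
      ← hp.strictMono_cdf.le_iff_le (a := x)]
    simp only [hg, hb]
  rw [Measure.map_apply hmono.measurable measurableSet_Iic, hpre,
    hp.densityMeasure_apply measurableSet_Iic, hq.densityMeasure_apply measurableSet_Iic, hb]

lemma cdf_eq_of_monotone_of_map_eq {p q : ℝ → ℝ} (hp : IsPositiveDensity p)
    (hq : IsPositiveDensity q) {g : ℝ → ℝ} (hmono : Monotone g)
    (hmap : (densityMeasure p).map g = densityMeasure q) (x : ℝ) :
    (∫ u in Iic (g x), q u) = ∫ u in Iic x, p u := by
  have := hp.isProbabilityMeasure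
  refine le_antisymm ?_ ?_
  · have hsub : g ⁻¹' Iio (g x) ⊆ Iic x := fun y hy =>
      le_of_lt (lt_of_not_ge fun hxy => (hmono hxy).not_gt hy)
    have hae : (densityMeasure q).real (Iic (g x)) = (densityMeasure q).real (Iio (g x)) :=
      measureReal_congr (Iio_ae_eq_Iic'
        (densityMeasure_singleton q (g x))).symm
    rw [← hp.densityMeasure_real_Iic, ← hq.densityMeasure_real_Iic, hae, ← hmap,
      map_measureReal_apply hmono.measurable measurableSet_Iio]
    exact measureReal_mono hsub
  · have hsub : Iic x ⊆ g ⁻¹' Iic (g x) := fun y hy => hmono hy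
    rw [← hp.densityMeasure_real_Iic, ← hq.densityMeasure_real_Iic, ← hmap,
      map_measureReal_apply hmono.measurable measurableSet_Iic]
    exact measureReal_mono hsub

section

variable {p₀ α γ : ℝ → ℝ}

lemma integral_Iic_backwardFlow_zero (hp : IsPositiveDensity p₀) (h : IsSchedule α γ) (x : ℝ) :
    (∫ u in Iic (backwardFlow p₀ α γ x 0), p₀ u) = ∫ u in Iic x, gaussianPDFReal 0 1 u := by
  simpa only [marginalCDF, marginalDensity_zero h, marginalDensity_one h] using
    marginalCDF_backwardFlow hp h x (left_mem_Icc.2 zero_le_one)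

lemma map_backwardFlow_zero (hp : IsPositiveDensity p₀) (h : IsSchedule α γ) :
    (gaussianReal 0 1).map (fun x₁ => backwardFlow p₀ α γ x₁ 0) = densityMeasure p₀ := by
  rw [← densityMeasure_gaussianPDFReal]
  exact map_eq_densityMeasure_of_cdf_eq isPositiveDensity_gaussianPDFReal hp
    (integral_Iic_backwardFlow_zero hp h)

lemma eq_backwardFlow_zero_of_monotone_of_map_eq (hp : IsPositiveDensity p₀)
    (h : IsSchedule α γ) {g : ℝ → ℝ} (hmono : Monotone g)
    (hmap : (gaussianReal 0 1).map g = densityMeasure p₀) :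
    g = fun x₁ => backwardFlow p₀ α γ x₁ 0 := by
  rw [← densityMeasure_gaussianPDFReal] at hmap
  refine funext fun x => hp.strictMono_cdf.injective ?_
  simp only [integral_Iic_backwardFlow_zero hp h]
  exact cdf_eq_of_monotone_of_map_eq isPositiveDensity_gaussianPDFReal hp hmono hmap x

end

end ProbabilityFlow

theorem mainTheorem4_general {Ω : Type*} [MeasurableSpace Ω] (P : Measure Ω)
    (p₀ : ℝ → ℝ) (hp₀ : ProbabilityFlow.IsPositiveDensity p₀)
    (z x₀ : Ω → ℝ) (hz : HasLaw z (gaussianReal 0 1) P)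
    (hx₀ : HasLaw x₀ (ProbabilityFlow.densityMeasure p₀) P) (hindep : IndepFun z x₀ P)
    (α γ : ℝ → ℝ) (hαγ : ProbabilityFlow.IsSchedule α γ) :
    (∀ t ∈ Icc (0 : ℝ) 1,
      ProbabilityFlow.IsPositiveDensity (ProbabilityFlow.marginalDensity p₀ α γ t) ∧
      HasLaw (ProbabilityFlow.forwardProcess α γ z x₀ t)
        (ProbabilityFlow.densityMeasure (ProbabilityFlow.marginalDensity p₀ α γ t)) P) ∧
    HasLaw (ProbabilityFlow.forwardProcess α γ z x₀ 0) (ProbabilityFlow.densityMeasure p₀) P ∧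
    HasLaw (ProbabilityFlow.forwardProcess α γ z x₀ 1) (gaussianReal 0 1) P ∧
    StrictMono (ProbabilityFlow.marginalCDF p₀ α γ 0) ∧
    BijOn (ProbabilityFlow.marginalCDF p₀ α γ 0) univ (Ioo 0 1) ∧
    (∀ x, ProbabilityFlow.marginalCDF p₀ α γ 1 x ∈ Ioo (0 : ℝ) 1) ∧
    ∃ X : ℝ → ℝ → ℝ,
      (∀ x₁, ProbabilityFlow.IsBackwardSolution p₀ α γ x₁ (X x₁) ∧
        (∀ y, ProbabilityFlow.IsBackwardSolution p₀ α γ x₁ y → EqOn y (X x₁) (Icc 0 1)) ∧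
        ContDiffOn ℝ 1 (X x₁) (Ico 0 1) ∧
        (Integrable (fun x => x * p₀ x) →
          ContDiffOn ℝ 1 (X x₁) (Icc 0 1) ∧
          HasDerivWithinAt (X x₁)
            (ProbabilityFlow.timeDeriv α 1 * x₁
              + ProbabilityFlow.timeDeriv γ 1 * ∫ x, x * p₀ x) (Icc 0 1) 1)) ∧
      (∀ x₁, X x₁ 0 = Function.invFun (ProbabilityFlow.marginalCDF p₀ α γ 0)
        (ProbabilityFlow.marginalCDF p₀ α γ 1 x₁)) ∧
      StrictMono (fun x₁ => X x₁ 0) ∧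
      (gaussianReal 0 1).map (fun x₁ => X x₁ 0) = ProbabilityFlow.densityMeasure p₀ ∧
      (∀ h : ℝ → ℝ, Monotone h →
        (gaussianReal 0 1).map h = ProbabilityFlow.densityMeasure p₀ →
        h = fun x₁ => X x₁ 0) := by
  have h0 : (0 : ℝ) ∈ Icc (0 : ℝ) 1 := left_mem_Icc.2 zero_le_one
  have h1 : (1 : ℝ) ∈ Icc (0 : ℝ) 1 := right_mem_Icc.2 zero_le_one
  have hlaw := fun t (ht : t ∈ Icc (0 : ℝ) 1) =>
    ProbabilityFlow.hasLaw_forwardProcess hp₀ hαγ hz hx₀ hindep ht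
  refine ⟨fun t ht => ⟨ProbabilityFlow.isPositiveDensity_marginalDensity hp₀ hαγ ht, hlaw t ht⟩,
    ?_, ?_, ProbabilityFlow.strictMono_marginalCDF hp₀ hαγ h0,
    ProbabilityFlow.bijOn_marginalCDF hp₀ hαγ h0,
    ProbabilityFlow.marginalCDF_one_mem_Ioo hαγ,
    ProbabilityFlow.backwardFlow p₀ α γ,
    fun x₁ => ⟨ProbabilityFlow.isBackwardSolution_backwardFlow hp₀ hαγ x₁,
      fun y hy => ProbabilityFlow.eqOn_backwardFlow hp₀ hαγ hy,
      ProbabilityFlow.contDiffOn_backwardFlow_Ico hp₀ hαγ x₁,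
      fun hpint => ⟨ProbabilityFlow.contDiffOn_backwardFlow_Icc hp₀ hαγ hpint x₁,
        ProbabilityFlow.hasDerivWithinAt_backwardFlow_one hp₀ hαγ hpint x₁⟩⟩,
    fun _ => rfl, ProbabilityFlow.strictMono_backwardFlow hp₀ hαγ h0,
    ProbabilityFlow.map_backwardFlow_zero hp₀ hαγ,
    fun g hg hmap =>
      ProbabilityFlow.eq_backwardFlow_zero_of_monotone_of_map_eq hp₀ hαγ hg hmap⟩
  · simpa only [ProbabilityFlow.marginalDensity_zero hαγ] using hlaw 0 h0
  · simpa only [ProbabilityFlow.marginalDensity_one hαγ,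
      ProbabilityFlow.densityMeasure_gaussianPDFReal] using hlaw 1 h1

theorem mainTheorem4 {Ω : Type*} [MeasurableSpace Ω] (P : Measure Ω) [IsProbabilityMeasure P]
    (p₀ : ℝ → ℝ) (hp₀ : ProbabilityFlow.IsPositiveDensity p₀)
    (A B : ℝ) (hscore : ∀ x, |ProbabilityFlow.score p₀ x| ≤ A + B * |x|)
    (z x₀ : Ω → ℝ) (hz : HasLaw z (gaussianReal 0 1) P)
    (hx₀ : HasLaw x₀ (ProbabilityFlow.densityMeasure p₀) P) (hindep : IndepFun z x₀ P)
    (α γ : ℝ → ℝ) (hαγ : ProbabilityFlow.IsSchedule α γ) :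
    -- `p_t` is a positive differentiable density of `x_t`, for every `t ∈ [0,1]`
    (∀ t ∈ Icc (0 : ℝ) 1,
      ProbabilityFlow.IsPositiveDensity (ProbabilityFlow.marginalDensity p₀ α γ t) ∧
      HasLaw (ProbabilityFlow.forwardProcess α γ z x₀ t)
        (ProbabilityFlow.densityMeasure (ProbabilityFlow.marginalDensity p₀ α γ t)) P) ∧
    -- `x_0 ∼ p₀` and `x_1 ∼ N(0,1)`
    HasLaw (ProbabilityFlow.forwardProcess α γ z x₀ 0) (ProbabilityFlow.densityMeasure p₀) P ∧
    HasLaw (ProbabilityFlow.forwardProcess α γ z x₀ 1) (gaussianReal 0 1) P ∧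
    -- `F_0` is an increasing bijection of `ℝ` onto `(0,1)`, and `F_1` has values in `(0,1)`
    StrictMono (ProbabilityFlow.marginalCDF p₀ α γ 0) ∧
    BijOn (ProbabilityFlow.marginalCDF p₀ α γ 0) univ (Ioo 0 1) ∧
    (∀ x, ProbabilityFlow.marginalCDF p₀ α γ 1 x ∈ Ioo (0 : ℝ) 1) ∧
    -- the flow `X x₁ t = x_t(x₁)` of the backward ODE
    ∃ X : ℝ → ℝ → ℝ,
      (∀ x₁, ProbabilityFlow.IsBackwardSolution p₀ α γ x₁ (X x₁) ∧
        (∀ y, ProbabilityFlow.IsBackwardSolution p₀ α γ x₁ y → EqOn y (X x₁) (Icc 0 1)) ∧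
        ContDiffOn ℝ 1 (X x₁) (Ico 0 1) ∧
        (Integrable (fun x => x * p₀ x) →
          ContDiffOn ℝ 1 (X x₁) (Icc 0 1) ∧
          HasDerivWithinAt (X x₁)
            (ProbabilityFlow.timeDeriv α 1 * x₁
              + ProbabilityFlow.timeDeriv γ 1 * ∫ x, x * p₀ x) (Icc 0 1) 1)) ∧
      (∀ x₁, X x₁ 0 = Function.invFun (ProbabilityFlow.marginalCDF p₀ α γ 0)
        (ProbabilityFlow.marginalCDF p₀ α γ 1 x₁)) ∧
      StrictMono (fun x₁ => X x₁ 0) ∧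
      (gaussianReal 0 1).map (fun x₁ => X x₁ 0) = ProbabilityFlow.densityMeasure p₀ ∧
      (∀ h : ℝ → ℝ, Monotone h →
        (gaussianReal 0 1).map h = ProbabilityFlow.densityMeasure p₀ →
        h = fun x₁ => X x₁ 0) :=
  mainTheorem4_general P p₀ hp₀ z x₀ hz hx₀ hindep α γ hαγ
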